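/- A \emph{digit space} $(X,D)$ is a non-empty compact metric space $(X,\rho)$ with a finite set $D$ of contractions $d : X^{\mathrm{ar}(d)} \to X$ (``digits'') of positive finite arity, powers of $X$ carrying the maximum metric, such that $X = \bigcup_{d \in D} \mathrm{range}(d)$. It is \emph{well-covering} if every $x \in X$ lies in the interior of $\mathrm{range}(d)$ for some $d\in D$. Let $Q = \{u_0, u_1, \dots\}$ be a countable dense subset of $X$; procedures below operate on indices of elements of $Q$ and on codes of rational numbers. $(X,D,Q)$ is a \emph{computable digit space} if the relations $\rho(u,v) < r$ and $\rho(u,v) > r$ on $Q \times Q \times \mathbb{Q}$ are recursively enumerable and every digit $d$ has a computable modulus of uniform continuity $\zeta : \mathbb{Q}_+ \to \mathbb{Q}_+$ and a procedure which, given $\vec u \in Q^{\mathrm{ar}(d)}$ and $n$, computes $v \in Q$ with $\rho(d(\vec u), v) < 2^{-n}$. It is \emph{decidable} if, for $u \in Q$, $\theta \in \mathbb{Q}_+$ and $d \in D$, it is decidable whether the open ball $B_\rho(u,\theta)$ is contained in $\mathrm{range}(d)$. It has \emph{approximable choice} if for every $d \in D$ there is an effective procedure $(\theta,u) \mapsto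 v^\theta_u \in Q^{\mathrm{ar}(d)}$, defined for $\theta \in \mathbb{Q}_+$ and $u \in \mathrm{int}(\mathrm{range}(d)) \cap Q$, such that for all $\theta, \tilde\theta \in \mathbb{Q}_+$ and all such $u$: (1) $\rho(v^\theta_u, v^{\tilde\theta}_u) < \max\{\theta, \tilde\theta\}$; (2) one can compute from $\theta$ some $\theta' \in \mathbb{Q}_+$ such that for all $u, u' \in \mathrm{int}(\mathrm{range}(d)) \cap Q$, $\rho(u,u') < \theta'$ implies $\rho(v^\theta_u, v^\theta_{u'}) < \theta$; (3) there is $\vec y$ with $d(\vec y) = u$ and $\rho(\vec y, v^\theta_u) < \theta$. Let $(X,D,Q)$ be a well-covering and decidable computable digit space with approximable choice, all of whose digits have arity $1$. Let $\mathcal{K}(X)$ be the space of non-empty compact subsets of $X$ with the Hausdorff metric $\rho_{\mathrm H}$, let $\mathcal{Q}_{\mathcal{K}(X)}$ be the set of non-empty finite subsets of $Q$, and let $\mathcal{K}(D)$ be the set of all maps $[d_1,\dots,d_r] : \mathcal{K}(X)^r \to \mathcal{K}(X)$, $[d_1,\dots,d_r](K_1,\dots,K_r) = \bigcup_{\kappa=1}^r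 d_\kappa[K_\kappa]$, with $r > 0$ and $d_1,\dots,d_r \in D$ pairwise distinct. Put \[ \mathbb{A}_{\mathcal{K}(X)}(K) :\Leftrightarrow (\forall n \in \mathbb{N})(\exists U \in \mathcal{Q}_{\mathcal{K}(X)})\ \rho_{\mathrm H}(K,U) < 2^{-n}, \] and let $\mathbb{C}_{\mathcal{K}(X)} \subseteq \mathcal{K}(X)$ be the largest set with \[ \mathbb{C}_{\mathcal{K}(X)}(K) \Leftrightarrow (\exists [d_1,\dots,d_r] \in \mathcal{K}(D))(\exists K_1,\dots,K_r \in \mathcal{K}(X))\ K = [d_1,\dots,d_r](K_1,\dots,K_r) \wedge (\forall \kappa \le r)\ \mathbb{C}_{\mathcal{K}(X)}(K_\kappa). \] A realiser of $\mathbb{A}_{\mathcal{K}(X)}(K)$ is a sequence $(U_n)_{n\in\mathbb N}$ in $\mathcal{Q}_{\mathcal{K}(X)}$ with $\rho_{\mathrm H}(K,U_n) < 2^{-n}$ for all $n$. The relation ``the tree $T$ is a realiser of $\mathbb{C}_{\mathcal{K}(X)}(K)$'', between infinite trees whose nodes are labelled by elements $[d_1,\dots,d_r]$ of $\mathcal{K}(D)$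 (a node with that label having exactly $r$ children) and elements $K$ of $\mathcal{K}(X)$, is the largest relation such that a tree with root label $[d_1,\dots,d_r]$ and immediate subtrees $T_1,\dots,T_r$ realises $\mathbb{C}_{\mathcal{K}(X)}(K)$ if and only if there are $K_1,\dots,K_r \in \mathcal{K}(X)$ such that $K = [d_1,\dots,d_r](K_1,\dots,K_r)$ and $T_\kappa$ realises $\mathbb{C}_{\mathcal{K}(X)}(K_\kappa)$ for all $\kappa$. Then $\mathbb{A}_{\mathcal{K}(X)} = \mathbb{C}_{\mathcal{K}(X)}$, and this equality holds effectively: there is a computable operator (on infinite sequences of codes) that transforms, for every $K \in \mathcal{K}(X)$, each realiser of $\mathbb{A}_{\mathcal{K}(X)}(K)$ into a realiser of $\mathbb{C}_{\mathcal{K}(X)}(K)$, and there is a computable operator that transforms, for every $K \in \mathcal{K}(X)$, each realiser of $\mathbb{C}_{\mathcal{K}(X)}(K)$ into a realiser of $\mathbb{A}_{\mathcal{K}(X)}(K)$. -/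

import Mathlib

open TopologicalSpace

noncomputable section

namespace DigitSpace

/-! ### Codes for rational numbers -/

/-- Every rational number is `ratCode (a, b, c) = (a - b) / (c + 1)` for some naturals `a b c`. -/
def ratCode (t : ℕ × ℕ × ℕ) : ℚ := ((t.1 : ℚ) - (t.2.1 : ℚ)) / ((t.2.2 : ℚ) + 1)

/-- Every positive rational number is `posRat (a, b) = (a + 1) / (b + 1)` for some naturals. -/
def posRat (t : ℕ × ℕ) : ℚ := ((t.1 : ℚ) + 1) / ((t.2 : ℚ) + 1)

/-! ### Extended iterated function systems and digit spaces -/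

/-- A finite family, indexed by `D`, of continuous maps `X ^ (ar d) → X` of positive finite arity
`ar d`. (Non-emptiness of `X` is part of `IsDigitSpace` below.) -/
structure ExtendedIFS (X : Type*) (D : Type*) [TopologicalSpace X] where
  finite_digits : Finite D
  ar : D → ℕ
  ar_pos : ∀ d, 0 < ar d
  map : ∀ d, (Fin (ar d) → X) → X
  continuous_map : ∀ d, Continuous (map d)

/-- Infinite `D`-trees: a set of words that is closed under prefixes (those with
`(label s).isSome`), together with a labelling of it by digits, such that the children of a node
labelled `d` are exactly its extensions by one of the letters `0, …, ar d - 1`. -/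
structure DTree {D : Type*} (ar : D → ℕ) where
  label : List ℕ → Option D
  root_mem : (label []).isSome
  append_mem_iff : ∀ (s : List ℕ) (i : ℕ),
    (label (s ++ [i])).isSome ↔ ∃ d, label s = some d ∧ i < ar d

namespace DTree

variable {D : Type*} {ar : D → ℕ}

/-- The label of the root. -/
def root (T : DTree ar) : D := (T.label []).get T.root_mem

/-- The immediate subtree with number `i`. -/
def subtree (T : DTree ar) (i : Fin (ar T.root)) : DTree ar where
  label s := T.label (i.1 :: s)
  root_mem := (T.append_mem_iff [] i.1).2 ⟨T.root, by simp [root], i.2⟩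
  append_mem_iff s j := T.append_mem_iff (i.1 :: s) j

/-- The tree as a point of Baire space: its labelling function, written in the standard
numberings of words and of labels. -/
def name [Encodable D] (T : DTree ar) : ℕ → ℕ :=
  fun n => Encodable.encode (T.label (Denumerable.ofNat (List ℕ) n))

end DTree

namespace ExtendedIFS

section Topological

variable {X D : Type*} [TopologicalSpace X] (S : ExtendedIFS X D)

/-- Every point lies in the range of some digit. -/
def IsCovering : Prop := ∀ x : X, ∃ d, x ∈ Set.range (S.map d)

/-- Every point lies in the interior of the range of some digit. -/
def IsWellCovering : Prop := ∀ x : X, ∃ d, x ∈ interior (Set.range (S.map d))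

/-- The co-inductive predicate `ℂ_X`, the largest `C` with
`C x ↔ ∃ d, ∃ y₁, …, y_{ar d}, x = d (y₁, …, y_{ar d}) ∧ ∀ κ, C y_κ`. -/
def coindSet : Set X :=
  OrderHom.gfp
    { toFun := fun C : Set X =>
        {x | ∃ d, ∃ y : Fin (S.ar d) → X, x = S.map d y ∧ ∀ κ, y κ ∈ C}
      monotone' := by
        rintro C C' h x ⟨d, y, hx, hy⟩
        exact ⟨d, y, hx, fun κ => h (hy κ)⟩ }

/-- The pairs `(T, x)` such that the tree `T` realises the statement `ℂ_X x`: the largest `R` with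
`([d; T₁, …, T_{ar d}], x) ∈ R ↔ ∃ y₁, …, y_{ar d}, x = d (y₁, …, y_{ar d}) ∧ ∀ κ, (T_κ, y_κ) ∈ R`.
-/
def treeRealisers : Set (DTree S.ar × X) :=
  OrderHom.gfp
    { toFun := fun R : Set (DTree S.ar × X) =>
        {p | ∃ y : Fin (S.ar p.1.root) → X,
          p.2 = S.map p.1.root y ∧ ∀ κ, (p.1.subtree κ, y κ) ∈ R}
      monotone' := by
        rintro R R' h p ⟨y, hx, hy⟩
        exact ⟨y, hx, fun κ => h (hy κ)⟩ }

/-- `p` is (the name of) a realiser of `ℂ_X x`. -/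
def IsTreeName [Encodable D] (p : ℕ → ℕ) (x : X) : Prop :=
  ∃ T : DTree S.ar, T.name = p ∧ (T, x) ∈ S.treeRealisers

end Topological

section Metric

variable {X D I : Type*} [MetricSpace X]

/-- Digit spaces: non-empty compact covering systems of contractions, where powers of `X` carry
the maximum metric. -/
structure IsDigitSpace (S : ExtendedIFS X D) : Prop where
  nonempty : Nonempty X
  compact : CompactSpace X
  covering : S.IsCovering
  contracting : ∀ d, ∃ q : NNReal, q < 1 ∧ LipschitzWith q (S.map d)

end Metric

end ExtendedIFS

/-! ### Computability

A countable dense subset `Q` of `X` is given by a surjective numbering `u : I → Q ⊆ X`, where `I`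
is a type of finite objects. Procedures work on indices of basic elements and on codes of
rational numbers. -/

/-- `X` with the basic elements `u i` is a computable metric space. -/
structure IsComputableMetric {X I : Type*} [MetricSpace X] [Primcodable I] (u : I → X) : Prop where
  dense : DenseRange u
  re_lt : REPred fun t : (I × I) × (ℕ × ℕ × ℕ) => dist (u t.1.1) (u t.1.2) < (ratCode t.2 : ℝ)
  re_gt : REPred fun t : (I × I) × (ℕ × ℕ × ℕ) => (ratCode t.2 : ℝ) < dist (u t.1.1) (u t.1.2)

/-- A map `h : X ^ k → X` is computable: it has a computable modulus of (uniform) continuity and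
its values at basic elements can be computably approximated. -/
def IsComputableMap {X I : Type*} [MetricSpace X] [Primcodable I] (u : I → X) {k : ℕ}
    (h : (Fin k → X) → X) : Prop :=
  (∃ ζ : ℕ × ℕ → ℕ × ℕ, Computable ζ ∧
    ∀ (ε : ℕ × ℕ) (x y : Fin k → X),
      dist x y < (posRat (ζ ε) : ℝ) → dist (h x) (h y) < (posRat ε : ℝ)) ∧
  (∃ G : (Fin k → I) × ℕ → I, Computable G ∧
    ∀ (i : Fin k → I) (n : ℕ), dist (h fun κ => u (i κ)) (u (G (i, n))) < (2 : ℝ)⁻¹ ^ n)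

namespace ExtendedIFS

variable {X D I : Type*} [MetricSpace X] [Primcodable I]

/-- Computable digit spaces, with basic elements `u i`. -/
structure IsComputableDigitSpace (S : ExtendedIFS X D) (u : I → X) : Prop where
  digitSpace : S.IsDigitSpace
  metric : IsComputableMetric u
  digits : ∀ d, IsComputableMap u (S.map d)

/-- For basic `u i`, positive rational `θ` and `d ∈ D` (there are only finitely many) it can be
decided whether the open ball of radius `θ` around `u i` is contained in the range of `d`. -/
def IsDecidable (S : ExtendedIFS X D) (u : I → X) : Prop :=
  ∀ d, ComputablePred fun t : I × (ℕ × ℕ) =>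
    Metric.ball (u t.1) (posRat t.2 : ℝ) ⊆ Set.range (S.map d)

/-- For every digit `d` there is an effective procedure `v`, defined (at least) for all positive
rationals `θ` and all basic elements in the interior of the range of `d`, with values in
`Q ^ (ar d)`, satisfying the three conditions of approximable choice. -/
def HasApproximableChoice (S : ExtendedIFS X D) (u : I → X) : Prop :=
  ∀ d, ∃ v : (ℕ × ℕ) × I →. (Fin (S.ar d) → I), Partrec v ∧
    (∀ θ i, u i ∈ interior (Set.range (S.map d)) → (v (θ, i)).Dom) ∧
    (∀ θ θ' i, u i ∈ interior (Set.range (S.map d)) →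
      ∀ a ∈ v (θ, i), ∀ b ∈ v (θ', i),
        dist (fun κ => u (a κ)) (fun κ => u (b κ)) < max (posRat θ : ℝ) (posRat θ' : ℝ)) ∧
    (∃ η : ℕ × ℕ → ℕ × ℕ, Computable η ∧
      ∀ θ i j, u i ∈ interior (Set.range (S.map d)) → u j ∈ interior (Set.range (S.map d)) →
        dist (u i) (u j) < (posRat (η θ) : ℝ) →
        ∀ a ∈ v (θ, i), ∀ b ∈ v (θ, j),
          dist (fun κ => u (a κ)) (fun κ => u (b κ)) < (posRat θ : ℝ)) ∧
    (∀ θ i, u i ∈ interior (Set.range (S.map d)) →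
      ∀ a ∈ v (θ, i), ∃ y : Fin (S.ar d) → X,
        S.map d y = u i ∧ dist y (fun κ => u (a κ)) < (posRat θ : ℝ))

end ExtendedIFS

/-! ### The Cauchy representation -/

section Cauchy

variable {X I : Type*} [MetricSpace X]

/-- The predicate `𝔸_X`. -/
def cauchySet (u : I → X) : Set X := {x | ∀ n : ℕ, ∃ i, dist x (u i) < (2 : ℝ)⁻¹ ^ n}

/-- `p` is (the name of) a realiser of `𝔸_X x`: a sequence of basic elements whose `n`-th member
has distance less than `2⁻ⁿ` from `x`. -/
def IsCauchyName [Encodable I] (u : I → X) (p : ℕ → ℕ) (x : X) : Prop :=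
  ∃ w : ℕ → I, (∀ n, p n = Encodable.encode (w n)) ∧
    ∀ n : ℕ, dist x (u (w n)) < (2 : ℝ)⁻¹ ^ n

end Cauchy

/-! ### Computable operators on Baire space -/

/-- The operator on Baire space given by `φ` maps `p` to `q`: on a finite initial segment of `p`
and an argument `n`, the program `φ` either gives no answer or answers `q n`, and it does answer
once the initial segment is long enough. -/
def OperatorMaps (φ : List ℕ → ℕ → Option ℕ) (p q : ℕ → ℕ) : Prop :=
  ∀ n, (∃ k, φ ((List.range k).map p) n = some (q n)) ∧
    ∀ k a, φ ((List.range k).map p) n = some a → a = q n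

/-- One computable (partial) operator on Baire space transforms, for every `x`, all `A`-names of
`x` into `B`-names of `x`. With `A`, `B` the realisability relations of two predicates, this says
that the inclusion of the first predicate in the second is computably realised. -/
def ComputablyTranslates {Y : Type*} (A B : (ℕ → ℕ) → Y → Prop) : Prop :=
  ∃ φ : List ℕ → ℕ → Option ℕ, Computable₂ φ ∧
    ∀ p y, A p y → ∃ q, OperatorMaps φ p q ∧ B q y

/-! ### The hyperspace of non-empty compact sets -/

/-- The basic subsets: the non-empty finite sets of basic elements, numbered by the non-empty
lists of indices, given by head and tail. -/
def basicSubset {X I : Type*} [TopologicalSpace X] (u : I → X) (l : I × List I) :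
    NonemptyCompacts X where
  carrier := {x | ∃ i ∈ l.1 :: l.2, x = u i}
  isCompact' := by
    have h : {x | ∃ i ∈ l.1 :: l.2, x = u i} = u '' {i | i ∈ l.1 :: l.2} := by
      ext x
      simp only [Set.mem_ofPred_eq, Set.mem_image, eq_comm]
    rw [h]
    exact ((List.finite_toSet _).image u).isCompact
  nonempty' := ⟨u l.1, l.1, List.mem_cons_self, rfl⟩

/-- Labels of the digits `[d₁, …, d_r]` of the hyperspace: `r > 0` and the `d_κ` are pairwise
distinct digits. -/
abbrev HyperDigit (D : Type*) : Type _ := {l : List D // l ≠ [] ∧ l.Nodup}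

namespace ExtendedIFS

variable {X D : Type*} [TopologicalSpace X]

/-- The digit `d` as a self-map of `X`, for `d` of arity one. -/
def unary (S : ExtendedIFS X D) (d : D) (x : X) : X := S.map d fun _ => x

theorem continuous_unary (S : ExtendedIFS X D) (d : D) : Continuous (S.unary d) :=
  (S.continuous_map d).comp (continuous_pi fun _ => continuous_id)

/-- `[d₁, …, d_r](K₁, …, K_r) = d₁[K₁] ∪ ⋯ ∪ d_r[K_r]`. -/
def hyperMap (S : ExtendedIFS X D) (e : HyperDigit D)
    (K : Fin e.1.length → NonemptyCompacts X) : NonemptyCompacts X where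
  carrier := ⋃ κ, S.unary (e.1.get κ) '' (K κ : Set X)
  isCompact' := isCompact_iUnion fun κ => (K κ).isCompact.image (S.continuous_unary _)
  nonempty' :=
    Set.nonempty_iUnion.2 ⟨⟨0, List.length_pos_iff.2 e.2.1⟩, (K _).nonempty.image _⟩

theorem continuous_hyperMap (S : ExtendedIFS X D) (e : HyperDigit D) :
    Continuous (S.hyperMap e) := by
  rw [NonemptyCompacts.isEmbedding_toCompacts.continuous_iff]
  have h : (NonemptyCompacts.toCompacts ∘ S.hyperMap e) = fun K => Finset.univ.sup fun κ =>
      (NonemptyCompacts.map (S.unary (e.1.get κ)) (S.continuous_unary _) (K κ)).toCompacts := by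
    funext K
    apply Compacts.ext
    rw [Compacts.coe_finset_sup]
    simp [hyperMap]
  rw [h]
  refine Continuous.finset_sup_apply (s := Finset.univ)
    (f := fun κ (K : Fin e.1.length → NonemptyCompacts X) =>
      (NonemptyCompacts.map (S.unary (e.1.get κ)) (S.continuous_unary _) (K κ)).toCompacts)
    fun κ _ => ?_
  exact NonemptyCompacts.continuous_toCompacts.comp
    ((S.continuous_unary _).nonemptyCompacts_map.comp (continuous_apply κ))

/-- The system `(𝒦(X), 𝒦(D))`, for a system `(X, D)` with unary digits only. -/
def hyper (S : ExtendedIFS X D) : ExtendedIFS (NonemptyCompacts X) (HyperDigit D) where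
  finite_digits := by
    classical
    have := S.finite_digits
    have := Fintype.ofFinite D
    exact Finite.of_injective
      (fun e : HyperDigit D => (⟨e.1, e.2.2⟩ : {l : List D // l.Nodup}))
      fun a b h => Subtype.ext (congrArg (fun l : {l : List D // l.Nodup} => l.1) h)
  ar e := e.1.length
  ar_pos e := List.length_pos_iff.2 e.2.1
  map e := S.hyperMap e
  continuous_map e := S.continuous_hyperMap e

end ExtendedIFS

end DigitSpace

end

/-!
From a Cauchy name `W` of `K` to a tree: let `2⁻ᶜ` be a Lebesgue number of the cover of `X` by the
interiors of the ranges of the digits. For a digit `d`, decidability selects the members of an early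
approximation in `W` whose `2⁻ᶜ`-balls lie in the range of `d`. Keeping in the later approximations
only the members that are linked to the selected ones by a chain of short steps gives a Cauchy
sequence for a compact part `M d` of `K` well inside the range of `d`, and `K` is the union of these
parts, because an approximating sequence of a point of `K` is itself such a chain. Approximable
choice turns the sequence for `M d` into a Cauchy name of some `L d` with `d '' L d = M d`. The
digits with a nonempty selection form the label of the root, and the names of the sets `L d` are
treated in the same way. Every label depends only on an initial segment of `W` of computable length.

From a tree to a Cauchy name: the digits have a common contraction factor `q < 1`, so a node of
depth `k` stands for a piece of `K` of diameter at most `q ^ k * diam X`. Applying the digits along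
the paths of length `k` approximately to one fixed basic element yields a finite set that is close
to `K`.

Since the basic elements are dense, every `K` has a Cauchy name, and by the first translation it
also has a tree.
-/

noncomputable section

namespace DigitSpace

section Computability

variable {α β δ σ : Type*} [Primcodable α] [Primcodable β] [Primcodable δ] [Primcodable σ]

theorem computable_list_foldl {f : α → List β} {g : α → σ} {h : α → σ → β → σ}
    (hf : Computable f) (hg : Computable g)
    (hh : Computable fun t : α × σ × β => h t.1 t.2.1 t.2.2) :
    Computable fun a => (f a).foldl (h a) (g a) := by
  have hrec : Computable fun a => Nat.rec (motive := fun _ => σ) (g a)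
      (fun n s => ((f a)[n]?).elim s (h a s)) (f a).length := by
    refine .nat_rec (h := fun a (q : ℕ × σ) => ((f a)[q.1]?).elim q.2 (h a q.2))
      (Computable.list_length.comp hf) hg ?_
    refine (Computable.option_casesOn (g := fun t : α × ℕ × σ => fun b => h t.1 t.2.2 b)
      (Computable.list_getElem?.comp (hf.comp .fst) (Computable.fst.comp .snd))
      (Computable.snd.comp .snd)
      (hh.comp (.pair (Computable.fst.comp .fst)
        (.pair (Computable.snd.comp (Computable.snd.comp .fst)) .snd)))).of_eq fun t => ?_
    dsimp only
    cases (f t.1)[t.2.1]? <;> rfl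
  refine hrec.of_eq fun a => ?_
  suffices h_take : ∀ n ≤ (f a).length, Nat.rec (motive := fun _ => σ) (g a)
      (fun n s => ((f a)[n]?).elim s (h a s)) n = ((f a).take n).foldl (h a) (g a) by
    simpa using h_take _ le_rfl
  intro n hn
  induction n with
  | zero => simp
  | succ n ih =>
    simp only [ih (Nat.le_of_succ_le hn), List.take_add_one, List.getElem?_eq_getElem hn,
      List.foldl_append]
    rfl

theorem computable_list_foldr {f : α → List β} {g : α → σ} {h : α → β → σ → σ}
    (hf : Computable f) (hg : Computable g)
    (hh : Computable fun t : α × β × σ => h t.1 t.2.1 t.2.2) :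
    Computable fun a => (f a).foldr (h a) (g a) :=
  (computable_list_foldl (h := fun a s b => h a b s) (Computable.list_reverse.comp hf) hg
    (hh.comp (.pair .fst (.pair (Computable.snd.comp .snd) (Computable.fst.comp .snd))))).of_eq
    fun _ => List.foldl_reverse

theorem computable_list_foldlM {f : α → List β} {g : α → σ} {h : α → σ → β → Option σ}
    (hf : Computable f) (hg : Computable g)
    (hh : Computable fun t : α × σ × β => h t.1 t.2.1 t.2.2) :
    Computable fun a => (f a).foldlM (h a) (g a) := by
  have hstep : Computable fun t : α × Option σ × β => t.2.1.bind fun s => h t.1 s t.2.2 :=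
    .option_bind (Computable.fst.comp .snd) (hh.comp (.pair (Computable.fst.comp .fst)
      (.pair .snd (Computable.snd.comp (Computable.snd.comp .fst)))))
  refine (computable_list_foldl (h := fun a o b => o.bind fun s => h a s b) hf
    (Computable.option_some.comp hg) hstep).of_eq fun a => ?_
  suffices hfold : ∀ (l : List β) (o : Option σ), l.foldl (fun o b => o.bind fun s => h a s b) o =
      o.bind fun s => l.foldlM (h a) s from hfold _ _
  intro l o
  induction l generalizing o with
  | nil => simp
  | cons b l ih => cases o <;> simp [ih]

theorem computable_list_filterMap {f : α → List β} {g : α → β → Option σ} (hf : Computable f)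
    (hg : Computable₂ g) : Computable fun a => (f a).filterMap (g a) := by
  have hstep : Computable fun t : α × β × List σ =>
      ((g t.1 t.2.1).map fun c => c :: t.2.2).getD t.2.2 :=
    .option_getD
      (.option_map (f := fun t : α × β × List σ => g t.1 t.2.1)
        (hg.comp .fst (Computable.fst.comp .snd))
        (Computable.list_cons.comp .snd (Computable.snd.comp (Computable.snd.comp .fst))))
      (Computable.snd.comp .snd)
  refine (computable_list_foldr (h := fun a b l => ((g a b).map fun c => c :: l).getD l)
    hf (.const []) hstep).of_eq fun a => ?_
  induction f a with
  | nil => rfl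
  | cons b l ih => cases h : g a b <;> simp [h, ih]

theorem computable_list_map {f : α → List β} {g : α → β → σ} (hf : Computable f)
    (hg : Computable₂ g) : Computable fun a => (f a).map (g a) :=
  (computable_list_filterMap (g := fun a b => some (g a b)) hf
    (Computable.option_some.comp hg)).of_eq fun a =>
    congrFun List.filterMap_eq_map (f a)

theorem computable_list_filter {f : α → List β} {p : α → β → Bool} (hf : Computable f)
    (hp : Computable₂ p) : Computable fun a => (f a).filter (p a) := by
  have hguard : Computable₂ fun a b => bif p a b then some b else none :=
    .cond hp (Computable.option_some.comp .snd) (.const none)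
  refine (computable_list_filterMap hf hguard).of_eq fun a => ?_
  rw [← List.filterMap_eq_filter]
  congr 1
  funext b
  cases h : p a b <;> simp [Option.guard, h]

theorem computable_list_any {f : α → List β} {p : α → β → Bool} (hf : Computable f)
    (hp : Computable₂ p) : Computable fun a => (f a).any (p a) :=
  (computable_list_foldr (h := fun a b c => p a b || c) hf (.const false)
    (Primrec.or.to_comp.comp (hp.comp .fst (Computable.fst.comp .snd))
      (Computable.snd.comp .snd))).of_eq fun a => by
        induction f a with
        | nil => rfl
        | cons b l ih => simp only [List.foldr_cons, List.any_cons, ih]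

theorem computable_nat_iterate {f : α → ℕ} {g : α → σ} {h : α → σ → σ} (hf : Computable f)
    (hg : Computable g) (hh : Computable₂ h) : Computable fun a => (h a)^[f a] (g a) :=
  (Computable.nat_rec (h := fun a (q : ℕ × σ) => h a q.2) hf hg
    (hh.comp .fst (Computable.snd.comp .snd))).of_eq fun a => by
      induction f a with
      | zero => rfl
      | succ n ih => rw [Function.iterate_succ_apply', ← ih]

theorem computable_two_pow : Computable fun n : ℕ => 2 ^ n :=
  (computable_nat_iterate (h := fun _ s => 2 * s) .id (.const 1)
    (Primrec.nat_mul.to_comp.comp (.const 2) .snd)).of_eq fun n => by simp [mul_left_iterate]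

theorem computable₂_of_finite [Finite δ] {f : δ → α → σ} (hf : ∀ d, Computable (f d)) :
    Computable₂ f := by
  let e := Finite.equivFin δ
  have hvec : Computable fun t : δ × α => List.Vector.ofFn fun i => f (e.symm i) t.2 :=
    .vector_ofFn fun i => (hf (e.symm i)).comp .snd
  exact (Computable.vector_get.comp hvec
    ((Primrec.dom_finite e).to_comp.comp .fst)).of_eq fun t => by simp

theorem exists_computable_bound [Finite δ] {f : δ → ℕ → ℕ} (hf : ∀ d, Computable (f d)) :
    ∃ g : ℕ → ℕ, Computable g ∧ ∀ d n, f d n ≤ g n := by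
  cases nonempty_fintype δ
  have hsum : Computable fun n => (Finset.univ.toList.map fun d => f d n).sum :=
    computable_list_foldr (h := fun _ a s => a + s)
      (computable_list_map (g := fun n d => f d n) (.const (Finset.univ : Finset δ).toList)
        ((computable₂_of_finite hf).comp .snd .fst))
      (.const 0)
      (Primrec.nat_add.to_comp.comp (Computable.fst.comp .snd) (Computable.snd.comp .snd))
  exact ⟨_, hsum, fun d n =>
    List.le_sum_of_mem (List.mem_map_of_mem (by simp : d ∈ Finset.univ.toList))⟩

theorem exists_computable_monotone_ge {f : ℕ → ℕ} (hf : Computable f) :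
    ∃ g : ℕ → ℕ, Computable g ∧ Monotone g ∧ f ≤ g := by
  refine ⟨fun n => Nat.rec (f 0) (fun k a => a + f (k + 1)) n, ?_,
    monotone_nat_of_le_succ fun n => Nat.le_add_right _ _, ?_⟩
  · exact .nat_rec (h := fun _ (q : ℕ × ℕ) => q.2 + f (q.1 + 1)) .id (.const (f 0))
      (Primrec.nat_add.to_comp.comp (Computable.snd.comp .snd)
        (hf.comp (Computable.succ.comp (Computable.fst.comp .snd))))
  · rintro (_ | n)
    exacts [le_rfl, Nat.le_add_left _ _]

theorem rePred_comp {p : β → Prop} {f : α → β} (hp : REPred p) (hf : Computable f) :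
    REPred fun a => p (f a) :=
  Partrec.comp hp hf

theorem exists_computable_separation {p q : α → Prop} (hp : REPred p) (hq : REPred q)
    (hpq : ∀ a, p a ∨ q a) :
    ∃ t : α → Bool, Computable t ∧ ∀ a, (t a = true → p a) ∧ (t a = false → q a) := by
  obtain ⟨k, hk, hmerge⟩ :=
    Partrec.merge' (hp.map (Computable.const true).to₂) (hq.map (Computable.const false).to₂)
  have hdom : ∀ a, (k a).Dom := fun a =>
    (hmerge a).2.2 ((hpq a).imp (fun h => ⟨h, trivial⟩) fun h => ⟨h, trivial⟩)
  refine ⟨fun a => (k a).get (hdom a), hk.of_eq_tot fun a => Part.get_mem _, fun a => ?_⟩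
  have hmem := (hmerge a).1 _ (Part.get_mem (hdom a))
  refine ⟨fun ht => ?_, fun ht => ?_⟩
  · rw [show (k a).get (hdom a) = true from ht] at hmem
    simpa [Part.mem_map_iff] using hmem
  · rw [show (k a).get (hdom a) = false from ht] at hmem
    simpa [Part.mem_map_iff] using hmem

theorem exists_computable_extension [Nonempty σ] {f : α →. σ} (hf : Partrec f) {p : α → Prop}
    (hp : ComputablePred p) (hdom : ∀ a, p a → (f a).Dom) :
    ∃ g : α → σ, Computable g ∧ ∀ a, p a → g a ∈ f a := by
  obtain ⟨c⟩ := ‹Nonempty σ›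
  obtain ⟨_, hp⟩ := hp
  have hcond : Partrec fun a => bif decide (p a) then f a else Part.some c :=
    .cond hp hf (Computable.const c)
  have htotal : ∀ a, (bif decide (p a) then f a else Part.some c).Dom := fun a => by
    by_cases ha : p a <;> simp [ha, hdom]
  refine ⟨_, hcond.of_eq_tot fun a => Part.get_mem (htotal a), fun a ha => ?_⟩
  have hmem := Part.get_mem (htotal a)
  simpa only [ha, decide_true, cond_true] using hmem

end Computability

section Names

theorem computablyTranslates_of_modulus {Y : Type*} {A B : (ℕ → ℕ) → Y → Prop}
    {F : List ℕ → ℕ → ℕ} {μ : ℕ → ℕ} (hF : Computable₂ F) (hμ : Computable μ)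
    (h : ∀ p y, A p y →
      ∃ q, B q y ∧ ∀ n k, μ n ≤ k → F ((List.range k).map p) n = q n) :
    ComputablyTranslates A B := by
  refine ⟨fun l n => bif decide (μ n ≤ l.length) then some (F l n) else none, ?_, fun p y hp => ?_⟩
  · exact .cond
      (Primrec.nat_le.decide.to_comp.comp (hμ.comp .snd) (Computable.list_length.comp .fst))
      (Computable.option_some.comp hF) (.const none)
  · obtain ⟨q, hq, hpq⟩ := h p y hp
    refine ⟨q, fun n => ⟨⟨μ n, by simp [hpq n _ le_rfl]⟩, fun k a ha => ?_⟩, hq⟩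
    by_cases hk : μ n ≤ k
    · simpa [hk, hpq n k hk, eq_comm] using ha
    · simp [hk] at ha

variable {α : Type*} [Primcodable α]

/-- The list with code `n`, and the empty list if there is none. -/
def decodeList (n : ℕ) : List α := (Encodable.decode n).getD []

@[simp]
theorem decodeList_encode (l : List α) : decodeList (Encodable.encode l) = l := by
  simp [decodeList]

theorem computable_decodeList : Computable (decodeList : ℕ → List α) :=
  Computable.option_getD .decode (.const [])

theorem encode_cons_pred (a : α) (l : List α) :
    (Encodable.encode (a :: l)).pred = Encodable.encode (a, l) := by
  rw [Encodable.encode_list_cons, Encodable.encode_prod_val, Nat.pred_succ]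

/-- The nonempty list which the number `n` codes by its head and tail. -/
def decodeCons (n : ℕ) : List α := decodeList (n + 1)

@[simp]
theorem decodeCons_encode (a : α) (l : List α) : decodeCons (Encodable.encode (a, l)) = a :: l := by
  rw [← encode_cons_pred, decodeCons, ← Nat.succ_eq_add_one, Nat.succ_pred]
  · exact decodeList_encode _
  · simp [Encodable.encode_list_cons]

theorem computable_decodeCons : Computable (decodeCons : ℕ → List α) :=
  computable_decodeList.comp .succ

end Names

section Nets

variable {X I : Type*} [MetricSpace X] {u : I → X} {l l' : List I} {K : NonemptyCompacts X}
  {r r' : ℝ}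

/-- The finite set of basic elements listed by `l` has Hausdorff distance at most `r` from `K`. -/
structure IsNet (u : I → X) (l : List I) (K : NonemptyCompacts X) (r : ℝ) : Prop where
  exists_index : ∀ x ∈ K, ∃ i ∈ l, dist x (u i) ≤ r
  exists_point : ∀ i ∈ l, ∃ x ∈ K, dist x (u i) ≤ r

theorem IsNet.mono (h : IsNet u l K r) (hr : r ≤ r') : IsNet u l K r' :=
  ⟨fun x hx => (h.1 x hx).imp fun _ h => ⟨h.1, h.2.trans hr⟩,
    fun i hi => (h.2 i hi).imp fun _ h => ⟨h.1, h.2.trans hr⟩⟩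

theorem IsNet.ne_nil (h : IsNet u l K r) : l ≠ [] := by
  obtain ⟨x, hx⟩ := K.nonempty
  obtain ⟨i, hi, -⟩ := h.exists_index x hx
  exact List.ne_nil_of_mem hi

theorem IsNet.exists_dist_le (h : IsNet u l K r) (h' : IsNet u l' K r') :
    ∀ i ∈ l, ∃ i' ∈ l', dist (u i) (u i') ≤ r + r' := by
  intro i hi
  obtain ⟨x, hx, hxi⟩ := h.exists_point i hi
  obtain ⟨i', hi', hxi'⟩ := h'.exists_index x hx
  exact ⟨i', hi', (dist_triangle_left _ _ x).trans (add_le_add hxi hxi')⟩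

theorem mem_basicSubset {i : I} {x : X} : x ∈ basicSubset u (i, l) ↔ ∃ j ∈ i :: l, x = u j :=
  Iff.rfl

theorem exists_dist_le_dist (K L : NonemptyCompacts X) {x : X} (hx : x ∈ K) :
    ∃ y ∈ L, dist x y ≤ dist K L := by
  obtain ⟨y, hy, hxy⟩ := L.isCompact.exists_infDist_eq_dist L.nonempty x
  refine ⟨y, hy, hxy ▸ ?_⟩
  exact Metric.infDist_le_hausdorffDist_of_mem hx
    (Metric.hausdorffEDist_ne_top_of_nonempty_of_bounded K.nonempty L.nonempty
      K.isCompact.isBounded L.isCompact.isBounded)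

theorem isNet_cons_iff {i : I} (hr : 0 ≤ r) :
    IsNet u (i :: l) K r ↔ dist K (basicSubset u (i, l)) ≤ r := by
  constructor
  · rintro ⟨h_index, h_point⟩
    refine Metric.hausdorffDist_le_of_mem_dist hr (fun x hx => ?_) ?_
    · obtain ⟨j, hj, hxj⟩ := h_index x hx
      exact ⟨u j, ⟨j, hj, rfl⟩, hxj⟩
    · rintro _ ⟨j, hj, rfl⟩
      simpa only [dist_comm, SetLike.mem_coe] using h_point j hj
  · refine fun h => ⟨fun x hx => ?_, fun j hj => ?_⟩
    · obtain ⟨_, ⟨j, hj, rfl⟩, hxj⟩ := exists_dist_le_dist K (basicSubset u (i, l)) hx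
      exact ⟨j, hj, hxj.trans h⟩
    · obtain ⟨x, hx, hjx⟩ := exists_dist_le_dist _ K (mem_basicSubset.2 ⟨j, hj, rfl⟩)
      exact ⟨x, hx, (dist_comm _ _).trans_le (hjx.trans ((dist_comm _ _).trans_le h))⟩

theorem mem_of_forall_exists_dist_le {A : Set X} (hA : IsClosed A) {C : ℝ} {x : X}
    (h : ∀ n : ℕ, ∃ y ∈ A, dist x y ≤ C * 2⁻¹ ^ n) : x ∈ A := by
  have h_tendsto : Filter.Tendsto (fun n : ℕ => C * (2 : ℝ)⁻¹ ^ n) Filter.atTop (nhds 0) := by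
    simpa using (tendsto_pow_atTop_nhds_zero_of_lt_one (r := (2 : ℝ)⁻¹) (by norm_num)
      (by norm_num)).const_mul C
  rw [← hA.closure_eq, Metric.mem_closure_iff]
  intro ε hε
  obtain ⟨n, hn⟩ := (h_tendsto.eventually_lt_const hε).exists
  obtain ⟨y, hy, hxy⟩ := h n
  exact ⟨y, hy, hxy.trans_lt hn⟩

theorem exists_isNet_of_geometric [CompactSpace X] {V : ℕ → List I} {C : ℝ} (h_ne : ∀ n, V n ≠ [])
    (h_succ : ∀ n, ∀ i ∈ V n, ∃ i' ∈ V (n + 1), dist (u i) (u i') ≤ C * 2⁻¹ ^ n)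
    (h_pred : ∀ n, ∀ i' ∈ V (n + 1), ∃ i ∈ V n, dist (u i) (u i') ≤ C * 2⁻¹ ^ n) :
    ∃ K, ∀ n, IsNet u (V n) K (2 * C * 2⁻¹ ^ n) := by
  choose a l hV using fun n => List.exists_cons_of_ne_nil (h_ne n)
  have hC : 0 ≤ C := by
    obtain ⟨i, -, hi⟩ := h_succ 0 (a 0) (by simp [hV])
    simpa using dist_nonneg.trans hi
  have h_step : ∀ n, dist (basicSubset u (a n, l n)) (basicSubset u (a (n + 1), l (n + 1))) ≤
      2 * C / 2 / 2 ^ n := fun n => by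
    rw [← isNet_cons_iff (by positivity), ← hV, mul_div_cancel_left₀ C two_ne_zero,
      div_eq_mul_inv, ← inv_pow]
    constructor
    · rintro _ ⟨i, hi, rfl⟩
      exact h_succ n i (hV n ▸ hi)
    · intro i' hi'
      obtain ⟨i, hi, hii'⟩ := h_pred n i' hi'
      exact ⟨u i, mem_basicSubset.2 ⟨i, hV n ▸ hi, rfl⟩, hii'⟩
  obtain ⟨K, hK⟩ := cauchySeq_tendsto_of_complete (cauchySeq_of_le_geometric_two h_step)
  refine ⟨K, fun n => ?_⟩
  rw [hV, isNet_cons_iff (by positivity), dist_comm, inv_pow, ← div_eq_mul_inv]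
  exact dist_le_of_le_geometric_two_of_tendsto h_step hK n

theorem exists_isNet_of_denseRange (hu : DenseRange u) (K : NonemptyCompacts X) (hr : 0 < r) :
    ∃ l, IsNet u l K r := by
  obtain ⟨t, htK, ht_fin, hKt⟩ := K.isCompact.finite_cover_balls (half_pos hr)
  choose a ha using fun x => hu.exists_dist_lt x (half_pos hr)
  refine ⟨ht_fin.toFinset.toList.map a, fun x hx => ?_, fun i hi => ?_⟩
  · obtain ⟨y, hy, hxy⟩ := Set.mem_iUnion₂.1 (hKt hx)
    refine ⟨a y, List.mem_map_of_mem (by simpa using hy), ?_⟩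
    linarith [dist_triangle x y (u (a y)), ha y, Metric.mem_ball.1 hxy]
  · obtain ⟨x, hx, rfl⟩ := List.mem_map.1 hi
    exact ⟨x, htK (by simpa using hx), by linarith [ha x]⟩

/-- The finite sets of basic elements listed by `W 0, W 1, …` converge to `K` with the speed
required of a Cauchy name. -/
def ConvergesTo (u : I → X) (W : ℕ → List I) (K : NonemptyCompacts X) : Prop :=
  ∀ n, IsNet u (W n) K (2⁻¹ ^ n)

theorem IsCauchyName.convergesTo [Primcodable I] {p : ℕ → ℕ}
    (h : IsCauchyName (basicSubset u) p K) : ConvergesTo u (fun n => decodeCons (p n)) K := by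
  obtain ⟨w, hp, hw⟩ := h
  intro n
  dsimp only
  rw [hp, decodeCons_encode, isNet_cons_iff (by positivity)]
  exact (hw n).le

theorem isCauchyName_of_isNet [Primcodable I] {V : ℕ → List I}
    (h : ∀ n, IsNet u (V n) K (2⁻¹ ^ (n + 1))) :
    IsCauchyName (basicSubset u) (fun n => (Encodable.encode (V n)).pred) K := by
  choose a l hV using fun n => List.exists_cons_of_ne_nil (h n).ne_nil
  refine ⟨fun n => (a n, l n), fun n => by simp only [hV, encode_cons_pred], fun n => ?_⟩
  refine ((isNet_cons_iff (by positivity)).1 (hV n ▸ h n)).trans_lt ?_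
  exact pow_lt_pow_right_of_lt_one₀ (by norm_num) (by norm_num) n.lt_succ_self

theorem cauchySet_basicSubset (hu : DenseRange u) : cauchySet (basicSubset u) = Set.univ := by
  refine Set.eq_univ_of_forall fun K n => ?_
  obtain ⟨l, hl⟩ := exists_isNet_of_denseRange hu K (by positivity : (0 : ℝ) < 2⁻¹ ^ (n + 1))
  obtain ⟨i, l, rfl⟩ := List.exists_cons_of_ne_nil hl.ne_nil
  refine ⟨(i, l), ((isNet_cons_iff (by positivity)).1 hl).trans_lt ?_⟩
  exact pow_lt_pow_right_of_lt_one₀ (by norm_num) (by norm_num) n.lt_succ_self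

end Nets

section Dyadic

/-- The code of `2⁻ᵏ`. -/
def dyadic (k : ℕ) : ℕ × ℕ := (0, 2 ^ k - 1)

theorem computable_dyadic : Computable dyadic :=
  (Computable.const 0).pair (Computable.pred.comp computable_two_pow)

theorem posRat_dyadic (k : ℕ) : (posRat (dyadic k) : ℝ) = 2⁻¹ ^ k := by
  simp [posRat, dyadic]

theorem ratCode_dyadic (a k : ℕ) : (ratCode (a, dyadic k) : ℝ) = a * 2⁻¹ ^ k := by
  simp [ratCode, dyadic, div_eq_mul_inv]

theorem inv_two_pow_le_posRat (t : ℕ × ℕ) : (2 : ℝ)⁻¹ ^ t.2 ≤ posRat t := by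
  have h : (t.2 : ℝ) + 1 ≤ 2 ^ t.2 := by exact_mod_cast Nat.lt_two_pow_self
  rw [inv_pow, ← one_div]
  push_cast [posRat]
  gcongr
  simp

theorem inv_two_pow_anti {k n : ℕ} (h : k ≤ n) : (2 : ℝ)⁻¹ ^ n ≤ 2⁻¹ ^ k :=
  pow_le_pow_of_le_one (by norm_num) (by norm_num) h

end Dyadic

theorem IsComputableMetric.exists_computable_near {X I : Type*} [MetricSpace X] [Primcodable I]
    {u : I → X} (hu : IsComputableMetric u) :
    ∃ near : (I × I) × ℕ → Bool, Computable near ∧ ∀ i j k,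
      (near ((i, j), k) = true → dist (u i) (u j) < 2 * 2⁻¹ ^ k) ∧
      (dist (u i) (u j) ≤ 3 / 2 * 2⁻¹ ^ k → near ((i, j), k) = true) := by
  have h_upper : REPred fun t : (I × I) × ℕ => dist (u t.1.1) (u t.1.2) < 2 * 2⁻¹ ^ t.2 :=
    (rePred_comp hu.re_lt (.pair .fst (.pair (.const 2) (computable_dyadic.comp .snd)))).of_eq
      fun t => by rw [ratCode_dyadic, Nat.cast_ofNat]
  have h_lower : REPred fun t : (I × I) × ℕ => 3 / 2 * 2⁻¹ ^ t.2 < dist (u t.1.1) (u t.1.2) :=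
    (rePred_comp hu.re_gt (.pair .fst (.pair (.const 3)
      (computable_dyadic.comp (Computable.succ.comp .snd))))).of_eq
      fun t => by rw [ratCode_dyadic, Nat.cast_ofNat, pow_succ', ← mul_assoc, div_eq_mul_inv]
  obtain ⟨near, hnear, h⟩ := exists_computable_separation h_upper h_lower fun t => by
    have : (0 : ℝ) < 2⁻¹ ^ t.2 := by positivity
    rcases lt_or_ge (dist (u t.1.1) (u t.1.2)) (2 * 2⁻¹ ^ t.2) with hlt | hge
    exacts [Or.inl hlt, Or.inr (by linarith)]
  refine ⟨near, hnear, fun i j k => ⟨(h ((i, j), k)).1, fun hle => ?_⟩⟩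
  by_contra hfalse
  exact ((h ((i, j), k)).2 (by simpa using hfalse)).not_ge hle

section Sections

variable {X I : Type*} [MetricSpace X]

/-- The indices of the basic elements whose `r`-ball lies in the range of `f`. -/
def innerIndices (f : X → X) (u : I → X) (r : ℝ) : Set I :=
  {i | Metric.ball (u i) r ⊆ Set.range f}

/-- The unary form of approximable choice: on the indices in `G`, the basic element with index
`pick n i` approximates an `f`-preimage of `u i` up to `2⁻ⁿ`, with modulus of continuity `J`. -/
structure IsApproxSection (f : X → X) (u : I → X) (G : Set I) (J : ℕ → ℕ) (pick : ℕ → I → I) :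
    Prop where
  dist_lt_of_dist_lt : ∀ n, ∀ i ∈ G, ∀ j ∈ G, dist (u i) (u j) < 2⁻¹ ^ J n →
    dist (u (pick n i)) (u (pick n j)) < 2⁻¹ ^ n
  dist_succ_lt : ∀ n, ∀ i ∈ G, dist (u (pick n i)) (u (pick (n + 1) i)) < 2⁻¹ ^ n
  exists_preimage : ∀ n, ∀ i ∈ G, ∃ y, f y = u i ∧ dist y (u (pick n i)) < 2⁻¹ ^ n

theorem IsApproxSection.mono {f : X → X} {u : I → X} {G : Set I} {J J' : ℕ → ℕ}
    {pick : ℕ → I → I} (h : IsApproxSection f u G J pick) (hJ : J ≤ J') :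
    IsApproxSection f u G J' pick where
  dist_lt_of_dist_lt n i hi j hj hij :=
    h.dist_lt_of_dist_lt n i hi j hj (hij.trans_le (inv_two_pow_anti (hJ n)))
  dist_succ_lt := h.dist_succ_lt
  exists_preimage := h.exists_preimage

namespace ExtendedIFS

variable {D : Type*} {S : ExtendedIFS X D} {d : D}

theorem map_eq_unary (hd : S.ar d = 1) (y : Fin (S.ar d) → X) :
    S.map d y = S.unary d (y ⟨0, S.ar_pos d⟩) := by
  have : Subsingleton (Fin (S.ar d)) := hd ▸ inferInstance
  exact congrArg (S.map d) (funext fun κ => congrArg y (Subsingleton.elim _ _))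

theorem range_unary (hd : S.ar d = 1) : Set.range (S.unary d) = Set.range (S.map d) := by
  refine Set.Subset.antisymm (Set.range_subset_iff.2 fun y => ⟨_, rfl⟩) ?_
  exact Set.range_subset_iff.2 fun y => ⟨_, (map_eq_unary hd y).symm⟩

theorem lipschitzWith_unary {q : NNReal} (h : LipschitzWith q (S.map d)) :
    LipschitzWith q (S.unary d) :=
  .of_dist_le_mul fun x y =>
    (h.dist_le_mul _ _).trans (mul_le_mul_of_nonneg_left (dist_pi_const_le x y) q.2)

theorem IsDigitSpace.exists_lipschitzWith (hS : S.IsDigitSpace) :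
    ∃ q : NNReal, q < 1 ∧ ∀ d, LipschitzWith q (S.unary d) := by
  have := S.finite_digits
  cases nonempty_fintype D
  choose q hq hlip using hS.contracting
  refine ⟨Finset.univ.sup q, (Finset.sup_lt_iff zero_lt_one).2 fun d _ => hq d, fun d => ?_⟩
  exact lipschitzWith_unary ((hlip d).weaken (Finset.le_sup (Finset.mem_univ d)))

theorem IsWellCovering.exists_ball_subset [CompactSpace X] (h : S.IsWellCovering) :
    ∃ c : ℕ, ∀ x, ∃ d, Metric.ball x (2⁻¹ ^ c) ⊆ Set.range (S.map d) := by
  obtain ⟨δ, hδ, hball⟩ := lebesgue_number_lemma_of_metric isCompact_univ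
    (fun d => isOpen_interior (s := Set.range (S.map d))) fun x _ => Set.mem_iUnion.2 (h x)
  obtain ⟨c, hc⟩ := exists_pow_lt_of_lt_one hδ (by norm_num : (2 : ℝ)⁻¹ < 1)
  refine ⟨c, fun x => ?_⟩
  obtain ⟨d, hd⟩ := hball x trivial
  exact ⟨d, (Metric.ball_subset_ball hc.le).trans (hd.trans interior_subset)⟩

variable [Primcodable I] {u : I → X}

theorem IsDecidable.computablePred_innerIndices (h : S.IsDecidable u) (hd : S.ar d = 1) (c : ℕ) :
    ComputablePred (· ∈ innerIndices (S.unary d) u (2⁻¹ ^ c)) := by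
  classical
  obtain ⟨_, hdec⟩ := h d
  refine ⟨inferInstance, (hdec.comp (Computable.id.pair (.const (dyadic c)))).of_eq fun i => ?_⟩
  simp [posRat_dyadic, innerIndices, range_unary hd]

theorem HasApproximableChoice.exists_isApproxSection [Nonempty I]
    (hchoice : S.HasApproximableChoice u) (hd : S.ar d = 1) {G : Set I}
    (hG : ComputablePred (· ∈ G))
    (hG_int : ∀ i ∈ G, u i ∈ interior (Set.range (S.map d))) :
    ∃ J pick, Computable J ∧ Computable₂ pick ∧ IsApproxSection (S.unary d) u G J pick := by
  obtain ⟨v, hv, hdom, hv_max, ⟨η, hη, hv_mod⟩, hv_pre⟩ := hchoice d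
  let z : Fin (S.ar d) := ⟨0, S.ar_pos d⟩
  have hG' : ComputablePred fun t : (ℕ × ℕ) × I => t.2 ∈ G := by
    obtain ⟨_, hG⟩ := hG
    exact ⟨inferInstance, hG.comp .snd⟩
  obtain ⟨w, hw, hwv⟩ :=
    exists_computable_extension hv hG' fun t ht => hdom t.1 t.2 (hG_int _ ht)
  refine ⟨fun n => (η (dyadic n)).2, fun n i => w (dyadic n, i) z,
    Computable.snd.comp (hη.comp computable_dyadic), ?_, fun n i hi j hj hij => ?_,
    fun n i hi => ?_, fun n i hi => ?_⟩
  · exact Computable.fin_app.comp (hw.comp (.pair (computable_dyadic.comp .fst) .snd)) (.const z)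
  · have h := hv_mod (dyadic n) i j (hG_int i hi) (hG_int j hj)
      (hij.trans_le (inv_two_pow_le_posRat _)) _ (hwv (_, i) hi) _ (hwv (_, j) hj)
    rw [posRat_dyadic] at h
    exact (dist_le_pi_dist _ _ z).trans_lt h
  · have h := hv_max (dyadic n) (dyadic (n + 1)) i (hG_int i hi) _ (hwv (_, i) hi) _
      (hwv (_, i) hi)
    rw [posRat_dyadic, posRat_dyadic, max_eq_left (inv_two_pow_anti n.le_succ)] at h
    exact (dist_le_pi_dist _ _ z).trans_lt h
  · obtain ⟨y, hy, h⟩ := hv_pre (dyadic n) i (hG_int i hi) _ (hwv (_, i) hi)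
    rw [posRat_dyadic] at h
    exact ⟨y z, by rw [← map_eq_unary hd, hy], (dist_le_pi_dist _ _ z).trans_lt h⟩

end ExtendedIFS

end Sections

/-- The data of the algorithm that splits a compact set along the ranges of the digits: `2⁻ˢᶜᵃˡᵉ` is
a Lebesgue number, `select` decides whether a ball of that radius lies in the range of a digit,
`near` compares distances with a tolerance, and `pick` and `modulus` form approximate sections of
the digits. -/
structure Splitter (D I : Type*) where
  scale : ℕ
  select : D → I → Bool
  near : (I × I) × ℕ → Bool
  modulus : ℕ → ℕ
  pick : D → ℕ → I → I

namespace Splitter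

section Splitting

variable {D I X : Type*} (P : Splitter D I)

/-- The index of the first approximation in which the splitter selects basic elements. -/
def base : ℕ := P.scale + 4

/-- The part of the `(base + j)`-th approximation that is linked by a chain through the earlier
approximations to a basic element selected for the digit `d`. -/
def thin (d : D) (W : ℕ → List I) : ℕ → List I
  | 0 => (W P.base).filter (P.select d)
  | j + 1 => (W (P.base + (j + 1))).filter fun i' =>
      (thin d W j).any fun i => P.near ((i, i'), P.base + j)

/-- A Cauchy sequence for the compact set that the digit `d` maps onto its part of the limit of
`W`. -/
def child (d : D) (W : ℕ → List I) (n : ℕ) : List I :=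
  (P.thin d W (P.modulus (n + 2))).map (P.pick d (n + 2))

/-- The digits needed to cover the limit of `W`. -/
def digits [Fintype D] (W : ℕ → List I) : List D :=
  Finset.univ.toList.filter fun d => (W P.base).any (P.select d)

theorem mem_digits [Fintype D] {P : Splitter D I} {d : D} {W : ℕ → List I} :
    d ∈ P.digits W ↔ ∃ i ∈ W P.base, P.select d i = true := by
  simp [digits]

theorem nodup_digits [Fintype D] (W : ℕ → List I) : (P.digits W).Nodup :=
  (Finset.nodup_toList _).filter _

/-- Computability of the components of a splitter. -/
structure IsComputable [Primcodable D] [Primcodable I] (P : Splitter D I) : Prop where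
  select : Computable₂ P.select
  near : Computable P.near
  modulus : Computable P.modulus
  pick : Computable fun t : D × ℕ × I => P.pick t.1 t.2.1 t.2.2

/-- Correctness of a splitter for the digits `f d` and the basic elements `u i`. -/
structure IsCorrect [MetricSpace X] (P : Splitter D I) (f : D → X → X) (u : I → X) : Prop where
  exists_ball_subset : ∀ x, ∃ d, Metric.ball x (2⁻¹ ^ P.scale) ⊆ Set.range (f d)
  select_iff : ∀ d i, P.select d i = true ↔ i ∈ innerIndices (f d) u (2⁻¹ ^ P.scale)
  dist_lt_of_near : ∀ i j k, P.near ((i, j), k) = true → dist (u i) (u j) < 2 * 2⁻¹ ^ k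
  near_of_dist_le : ∀ i j k, dist (u i) (u j) ≤ 3 / 2 * 2⁻¹ ^ k → P.near ((i, j), k) = true
  modulus_mono : Monotone P.modulus
  le_modulus : ∀ n, n ≤ P.modulus n
  isApproxSection : ∀ d, IsApproxSection (f d) u (innerIndices (f d) u (2⁻¹ ^ (P.scale + 1)))
    P.modulus (P.pick d)
  lipschitz : ∀ d, LipschitzWith 1 (f d)

variable [MetricSpace X] {P} {f : D → X → X} {u : I → X} {W : ℕ → List I}
  {K L M : NonemptyCompacts X} {d : D}

theorem thin_subset (d : D) (W : ℕ → List I) : ∀ j, P.thin d W j ⊆ W (P.base + j)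
  | 0 => List.filter_subset_self _
  | _ + 1 => List.filter_subset_self _

theorem mem_thin_succ {j : ℕ} {i' : I} : i' ∈ P.thin d W (j + 1) ↔
    i' ∈ W (P.base + (j + 1)) ∧ ∃ i ∈ P.thin d W j, P.near ((i, i'), P.base + j) = true := by
  simp [thin]

/-- `M` is the limit of the thinned approximations for the digit `d`: a part of the limit of
`W` that lies well inside the range of `d`. -/
def IsPart (P : Splitter D I) (u : I → X) (d : D) (W : ℕ → List I) (M : NonemptyCompacts X) :
    Prop :=
  ∀ j, IsNet u (P.thin d W j) M (2⁻¹ ^ (P.scale + 2) * 2⁻¹ ^ j)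

theorem IsPart.exists_dist_thin_lt (hM : P.IsPart u d W M) {m j k : ℕ} (hj : m ≤ j)
    (hk : m ≤ k) : ∀ i ∈ P.thin d W j, ∃ i' ∈ P.thin d W k, dist (u i) (u i') < 2⁻¹ ^ m := by
  intro i hi
  obtain ⟨i', hi', h⟩ := (hM j).exists_dist_le (hM k) i hi
  refine ⟨i', hi', h.trans_lt ?_⟩
  have h_scale : (2 : ℝ)⁻¹ ^ (P.scale + 2) ≤ 2⁻¹ ^ 2 := inv_two_pow_anti (Nat.le_add_left _ _)
  have h_pos : (0 : ℝ) < 2⁻¹ ^ m := by positivity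
  nlinarith [inv_two_pow_anti hj, inv_two_pow_anti hk,
    (by positivity : (0 : ℝ) < 2⁻¹ ^ j), (by positivity : (0 : ℝ) < 2⁻¹ ^ k)]

theorem IsPart.subset (hM : P.IsPart u d W M) (hW : ConvergesTo u W K) : (M : Set X) ⊆ K := by
  intro x hx
  refine mem_of_forall_exists_dist_le K.isCompact.isClosed (C := 2) fun j => ?_
  obtain ⟨i, hi, hxi⟩ := (hM j).exists_index x hx
  obtain ⟨y, hy, hyi⟩ := (hW _).exists_point i (thin_subset d W j hi)
  have h_base : (2 : ℝ)⁻¹ ^ (P.base + j) ≤ 2⁻¹ ^ j := inv_two_pow_anti (j.le_add_left _)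
  rw [← pow_add] at hxi
  have h_scale := inv_two_pow_anti (j.le_add_left (P.scale + 2))
  exact ⟨y, hy, by linarith [dist_triangle_right x y (u i)]⟩

theorem IsPart.mem_of_forall_exists_thin (hM : P.IsPart u d W M) {x : X}
    (hx : ∀ j, ∃ i ∈ P.thin d W j, dist x (u i) ≤ 2⁻¹ ^ j) : x ∈ M := by
  refine mem_of_forall_exists_dist_le M.isCompact.isClosed (C := 2) fun j => ?_
  obtain ⟨i, hi, hxi⟩ := hx j
  obtain ⟨y, hy, hyi⟩ := (hM j).exists_point i hi
  rw [← pow_add] at hyi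
  have h_scale := inv_two_pow_anti (j.le_add_left (P.scale + 2))
  exact ⟨y, hy, by linarith [dist_triangle_right x y (u i)]⟩

namespace IsCorrect

theorem near_of_dist_le_of_dist_le (hP : P.IsCorrect f u) {x : X} {k : ℕ} {i i' : I}
    (hi : dist x (u i) ≤ 2⁻¹ ^ k) (hi' : dist x (u i') ≤ 2⁻¹ ^ (k + 1)) :
    P.near ((i, i'), k) = true := by
  refine hP.near_of_dist_le i i' k ((dist_triangle_left _ _ x).trans ?_)
  rw [pow_succ] at hi'
  linarith

theorem exists_mem_thin_succ (hP : P.IsCorrect f u) (hW : ConvergesTo u W K) {j : ℕ} {i : I}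
    (hi : i ∈ P.thin d W j) :
    ∃ i' ∈ P.thin d W (j + 1), P.near ((i, i'), P.base + j) = true := by
  obtain ⟨x, hx, hxi⟩ := (hW _).exists_point i (thin_subset d W j hi)
  obtain ⟨i', hi', hxi'⟩ := (hW (P.base + (j + 1))).exists_index x hx
  have h_near := hP.near_of_dist_le_of_dist_le hxi hxi'
  exact ⟨i', mem_thin_succ.2 ⟨hi', i, hi, h_near⟩, h_near⟩

theorem exists_isPart [CompactSpace X] (hP : P.IsCorrect f u) (hW : ConvergesTo u W K)
    (h_ne : P.thin d W 0 ≠ []) : ∃ M, P.IsPart u d W M := by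
  have h_radius : (2 : ℝ)⁻¹ ^ (P.scale + 2) = 2 * (2 * 2⁻¹ ^ P.base) := by
    rw [base]
    ring
  have h_dist : ∀ j i i', P.near ((i, i'), P.base + j) = true →
      dist (u i) (u i') ≤ 2 * 2⁻¹ ^ P.base * 2⁻¹ ^ j := fun j i i' h => by
    simpa only [pow_add, mul_assoc] using (hP.dist_lt_of_near _ _ _ h).le
  simp only [IsPart, h_radius]
  refine exists_isNet_of_geometric (fun j => ?_) (fun j i hi => ?_) fun j i' hi' => ?_
  · induction j with
    | zero => exact h_ne
    | succ j ih =>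
      obtain ⟨i, hi⟩ := List.exists_mem_of_ne_nil _ ih
      obtain ⟨i', hi', -⟩ := hP.exists_mem_thin_succ hW hi
      exact List.ne_nil_of_mem hi'
  · obtain ⟨i', hi', h_near⟩ := hP.exists_mem_thin_succ hW hi
    exact ⟨i', hi', h_dist j i i' h_near⟩
  · obtain ⟨-, i, hi, h_near⟩ := mem_thin_succ.1 hi'
    exact ⟨i, hi, h_dist j i i' h_near⟩

theorem mem_innerIndices_of_mem_thin (hP : P.IsCorrect f u) (hM : P.IsPart u d W M)
    {j : ℕ} {i : I} (hi : i ∈ P.thin d W j) :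
    i ∈ innerIndices (f d) u (2⁻¹ ^ (P.scale + 1)) := by
  obtain ⟨i₀, hi₀, h_dist⟩ := (hM j).exists_dist_le (hM 0) i hi
  have h_select := (hP.select_iff d i₀).1 (List.mem_filter.1 hi₀).2
  refine (Metric.ball_subset_ball' ?_).trans h_select
  have h_pow : (2 : ℝ)⁻¹ ^ j ≤ 2⁻¹ ^ 0 := inv_two_pow_anti j.zero_le
  have h_pos : (0 : ℝ) < 2⁻¹ ^ P.scale := by positivity
  rw [pow_add] at *
  rw [pow_succ]
  nlinarith

theorem dist_pick_lt (hP : P.IsCorrect f u) (hM : P.IsPart u d W M) {n j k : ℕ} {i i' : I}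
    (hi : i ∈ P.thin d W j) (hi' : i' ∈ P.thin d W k)
    (h_dist : dist (u i) (u i') < 2⁻¹ ^ P.modulus (n + 2)) :
    dist (u (P.pick d (n + 2) i)) (u (P.pick d (n + 3) i')) ≤ 1 / 2 * 2⁻¹ ^ n := by
  have hi := hP.mem_innerIndices_of_mem_thin hM hi
  have hi' := hP.mem_innerIndices_of_mem_thin hM hi'
  have h_mod := (hP.isApproxSection d).dist_lt_of_dist_lt (n + 2) i hi i' hi' h_dist
  have h_succ := (hP.isApproxSection d).dist_succ_lt (n + 2) i' hi'
  refine (dist_triangle _ (u (P.pick d (n + 2) i')) _).trans ?_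
  rw [pow_add] at h_mod h_succ
  linarith

theorem exists_convergesTo_child [CompactSpace X] (hP : P.IsCorrect f u)
    (hM : P.IsPart u d W M) : ∃ L, ConvergesTo u (P.child d W) L := by
  have h_mono : ∀ n, P.modulus (n + 2) ≤ P.modulus (n + 3) := fun n =>
    hP.modulus_mono (n + 2).le_succ
  obtain ⟨L, hL⟩ : ∃ L, ∀ n, IsNet u (P.child d W n) L (2 * (1 / 2) * 2⁻¹ ^ n) := by
    refine exists_isNet_of_geometric (fun n => ?_) (fun n => ?_) fun n => ?_
    · exact mt List.map_eq_nil_iff.1 (hM _).ne_nil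
    · refine List.forall_mem_map.2 fun i hi => ?_
      obtain ⟨i', hi', h⟩ := hM.exists_dist_thin_lt le_rfl (h_mono n) i hi
      exact ⟨_, List.mem_map_of_mem hi', hP.dist_pick_lt hM hi hi' h⟩
    · refine List.forall_mem_map.2 fun i' hi' => ?_
      obtain ⟨i, hi, h⟩ := hM.exists_dist_thin_lt (h_mono n) le_rfl i' hi'
      exact ⟨_, List.mem_map_of_mem hi, hP.dist_pick_lt hM hi hi' (by rwa [dist_comm])⟩
  exact ⟨L, fun n => by simpa using hL n⟩

theorem dist_map_pick_le (hP : P.IsCorrect f u) (hM : P.IsPart u d W M) {n j : ℕ} {i : I}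
    (hi : i ∈ P.thin d W j) : dist (u i) (f d (u (P.pick d n i))) ≤ 2⁻¹ ^ n := by
  obtain ⟨y, hy, hdist⟩ := (hP.isApproxSection d).exists_preimage n i
    (hP.mem_innerIndices_of_mem_thin hM hi)
  rw [← hy]
  simpa using ((hP.lipschitz d).dist_le_mul_of_le hdist.le)

theorem image_eq_of_convergesTo_child (hP : P.IsCorrect f u) (hM : P.IsPart u d W M)
    (hL : ConvergesTo u (P.child d W) L) : f d '' L = M := by
  have h_radius : ∀ n, (2 : ℝ)⁻¹ ^ (P.scale + 2) * 2⁻¹ ^ P.modulus (n + 2) ≤ 2⁻¹ ^ n := fun n => by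
    rw [← pow_add]
    exact inv_two_pow_anti (by have := hP.le_modulus (n + 2); omega)
  have h_anti : ∀ n, (2 : ℝ)⁻¹ ^ (n + 2) ≤ 2⁻¹ ^ n := fun n => inv_two_pow_anti (n.le_add_right 2)
  have h_lip : ∀ x y, dist (f d x) (f d y) ≤ dist x y := fun x y => by
    simpa using (hP.lipschitz d).dist_le_mul x y
  apply Set.Subset.antisymm
  · rintro _ ⟨y, hy, rfl⟩
    refine mem_of_forall_exists_dist_le M.isCompact.isClosed (C := 3) fun n => ?_
    obtain ⟨_, hi, hyi⟩ := (hL n).exists_index y hy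
    obtain ⟨i, hi', rfl⟩ := List.mem_map.1 hi
    obtain ⟨x, hx, hxi⟩ := (hM _).exists_point i hi'
    refine ⟨x, hx, ?_⟩
    linarith [dist_triangle4_right (f d y) x (f d (u (P.pick d (n + 2) i))) (u i),
      h_lip y (u (P.pick d (n + 2) i)), hP.dist_map_pick_le hM (n := n + 2) hi', h_radius n,
      h_anti n, dist_comm (u i) (f d (u (P.pick d (n + 2) i)))]
  · intro x hx
    refine mem_of_forall_exists_dist_le
      (L.isCompact.image (hP.lipschitz d).continuous).isClosed (C := 3) fun n => ?_
    obtain ⟨i, hi, hxi⟩ := (hM (P.modulus (n + 2))).exists_index x hx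
    obtain ⟨y, hy, hyi⟩ := (hL n).exists_point _ (List.mem_map_of_mem hi)
    refine ⟨f d y, ⟨y, hy, rfl⟩, ?_⟩
    linarith [dist_triangle4 x (u i) (f d (u (P.pick d (n + 2) i))) (f d y),
      h_lip y (u (P.pick d (n + 2) i)), hP.dist_map_pick_le hM (n := n + 2) hi, h_radius n,
      h_anti n, dist_comm (f d y) (f d (u (P.pick d (n + 2) i)))]

theorem exists_mem_digits_forall_mem_thin [Fintype D] (hP : P.IsCorrect f u)
    (hW : ConvergesTo u W K) {x : X} (hx : x ∈ K) :
    ∃ d ∈ P.digits W, ∀ j, ∃ i ∈ P.thin d W j, dist x (u i) ≤ 2⁻¹ ^ j := by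
  choose i hi hxi using fun j => (hW (P.base + j)).exists_index x hx
  obtain ⟨d, hd⟩ := hP.exists_ball_subset (u (i 0))
  have h_select : P.select d (i 0) = true := (hP.select_iff d (i 0)).2 hd
  have h_thin : ∀ j, i j ∈ P.thin d W j := fun j => by
    induction j with
    | zero => exact List.mem_filter.2 ⟨hi 0, h_select⟩
    | succ j ih =>
      exact mem_thin_succ.2 ⟨hi (j + 1), i j, ih, hP.near_of_dist_le_of_dist_le (hxi j)
        (hxi (j + 1))⟩
  exact ⟨d, mem_digits.2 ⟨i 0, hi 0, h_select⟩, fun j =>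
    ⟨i j, h_thin j, (hxi j).trans (inv_two_pow_anti (j.le_add_left _))⟩⟩

theorem digits_ne_nil [Fintype D] (hP : P.IsCorrect f u) (hW : ConvergesTo u W K) :
    P.digits W ≠ [] := by
  obtain ⟨x, hx⟩ := K.nonempty
  obtain ⟨d, hd, -⟩ := hP.exists_mem_digits_forall_mem_thin hW hx
  exact List.ne_nil_of_mem hd

theorem exists_isPart_of_mem_digits [Fintype D] [CompactSpace X] (hP : P.IsCorrect f u)
    (hW : ConvergesTo u W K) (hd : d ∈ P.digits W) : ∃ M, P.IsPart u d W M := by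
  obtain ⟨i, hi⟩ := mem_digits.1 hd
  exact hP.exists_isPart hW (List.ne_nil_of_mem (List.mem_filter.2 hi))

theorem exists_split [Fintype D] [CompactSpace X] (hP : P.IsCorrect f u)
    (hW : ConvergesTo u W K) :
    ∃ L : D → NonemptyCompacts X, (∀ d ∈ P.digits W, ConvergesTo u (P.child d W) (L d)) ∧
      (K : Set X) = ⋃ d ∈ P.digits W, f d '' L d := by
  have : Nonempty (NonemptyCompacts X) := ⟨K⟩
  choose! M hM using fun d (hd : d ∈ P.digits W) => hP.exists_isPart_of_mem_digits hW hd
  choose! L hL using fun d hd => hP.exists_convergesTo_child (hM d hd)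
  refine ⟨L, hL, Set.Subset.antisymm (fun x hx => ?_) (Set.iUnion₂_subset fun d hd => ?_)⟩
  · obtain ⟨d, hd, hxd⟩ := hP.exists_mem_digits_forall_mem_thin hW hx
    refine Set.mem_iUnion₂.2 ⟨d, hd, ?_⟩
    rw [hP.image_eq_of_convergesTo_child (hM d hd) (hL d hd)]
    exact (hM d hd).mem_of_forall_exists_thin hxd
  · rw [hP.image_eq_of_convergesTo_child (hM d hd) (hL d hd)]
    exact (hM d hd).subset hW

end IsCorrect

end Splitting

end Splitter

theorem ExtendedIFS.IsComputableDigitSpace.exists_splitter {X D I : Type*} [MetricSpace X]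
    [Primcodable D] [Primcodable I] [Nonempty I] {S : ExtendedIFS X D} {u : I → X}
    (hS : S.IsComputableDigitSpace u) (hcov : S.IsWellCovering) (hdec : S.IsDecidable u)
    (hchoice : S.HasApproximableChoice u) (hunary : ∀ d, S.ar d = 1) :
    ∃ P : Splitter D I, P.IsComputable ∧ P.IsCorrect S.unary u := by
  have := hS.digitSpace.compact
  have := S.finite_digits
  obtain ⟨c, hc⟩ := hcov.exists_ball_subset
  obtain ⟨near, h_near, h_near_iff⟩ := hS.metric.exists_computable_near
  obtain ⟨q, hq, hlip⟩ := hS.digitSpace.exists_lipschitzWith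
  have h_select : ∀ d, ∃ s : I → Bool, Computable s ∧
      ∀ i, s i = true ↔ i ∈ innerIndices (S.unary d) u (2⁻¹ ^ c) := fun d => by
    obtain ⟨_, h⟩ := hdec.computablePred_innerIndices (hunary d) c
    exact ⟨_, h, fun i => decide_eq_true_iff⟩
  choose select h_select h_select_iff using h_select
  have h_int : ∀ d, ∀ i ∈ innerIndices (S.unary d) u (2⁻¹ ^ (c + 1)),
      u i ∈ interior (Set.range (S.map d)) := fun d i hi => by
    rw [← range_unary (hunary d)]
    exact mem_interior.2 ⟨_, hi, Metric.isOpen_ball, Metric.mem_ball_self (by positivity)⟩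
  choose J pick hJ h_pick h_section using fun d => hchoice.exists_isApproxSection (hunary d)
    (hdec.computablePred_innerIndices (hunary d) (c + 1)) (h_int d)
  obtain ⟨J', hJ', hJJ'⟩ := exists_computable_bound hJ
  obtain ⟨J'', hJ'', h_mono, h_le⟩ := exists_computable_monotone_ge
    (Primrec.nat_max.to_comp.comp hJ' .id)
  refine ⟨⟨c, select, near, J'', pick⟩,
    ⟨computable₂_of_finite h_select, h_near, hJ'', computable₂_of_finite h_pick⟩, ?_⟩
  exact
    { exists_ball_subset := fun x => (hc x).imp fun d hd => (range_unary (hunary d)).symm ▸ hd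
      select_iff := h_select_iff
      dist_lt_of_near := fun i j k => (h_near_iff i j k).1
      near_of_dist_le := fun i j k => (h_near_iff i j k).2
      modulus_mono := h_mono
      le_modulus := fun n => (le_max_right _ _).trans (h_le n)
      isApproxSection := fun d =>
        (h_section d).mono fun n => (hJJ' d n).trans ((le_max_left _ _).trans (h_le n))
      lipschitz := fun d => (hlip d).weaken hq.le }

section Entries

variable {α : Type*}

/-- The sequence of lists that starts with the members of `L` and continues with empty lists. -/
def entries (L : List (List α)) (n : ℕ) : List α := (L[n]?).getD []

theorem entries_of_length_le {L : List (List α)} {n : ℕ} (h : L.length ≤ n) : entries L n = [] := by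
  simp [entries, h]

theorem computable_entries [Primcodable α] : Computable₂ (entries : List (List α) → ℕ → List α) :=
  Computable.option_getD Computable.list_getElem? (.const [])

end Entries

namespace Splitter

section Labels

variable {D I : Type*} {P : Splitter D I} {W W' : ℕ → List I} {d : D}

/-- The index up to which a sequence has to be known in order to compute its children up to the
index `n`. -/
def lookahead (P : Splitter D I) (n : ℕ) : ℕ := P.base + P.modulus (n + 2)

theorem thin_congr {j : ℕ} (h : Set.EqOn W W' (Set.Iic (P.base + j))) :
    P.thin d W j = P.thin d W' j := by
  induction j with
  | zero => exact congrArg _ (h (Set.mem_Iic.2 le_rfl))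
  | succ j ih =>
    simp only [thin, h (Set.mem_Iic.2 le_rfl),
      ih (h.mono (Set.Iic_subset_Iic.2 (Nat.le_succ _)))]

theorem child_congr {n : ℕ} (h : Set.EqOn W W' (Set.Iic (P.lookahead n))) :
    P.child d W n = P.child d W' n := by
  rw [child, child, thin_congr h]

/-- The child of the finite sequence `L` for the digit `d`, as a finite sequence. -/
def childList (P : Splitter D I) (L : List (List I)) (d : D) : List (List I) :=
  (List.range L.length).map (P.child d (entries L))

theorem entries_childList (h_le : ∀ n, n ≤ P.modulus n) (L : List (List I)) :
    entries (P.childList L d) = P.child d (entries L) := by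
  funext n
  rcases lt_or_ge n L.length with hn | hn
  · simp [entries, childList, hn]
  · have h_empty : P.thin d (entries L) (P.modulus (n + 2)) = [] := by
      have := h_le (n + 2)
      rw [← List.subset_nil, ← entries_of_length_le (L := L) (n := P.base + P.modulus (n + 2))
        (by omega)]
      exact thin_subset _ _ _
    simp [entries_of_length_le, childList, hn, child, h_empty]

variable [Fintype D]

/-- The digits that label the node `s` of the tree of the limit of `W`. -/
def label (P : Splitter D I) : (ℕ → List I) → List ℕ → Option (List D)
  | W, [] => some (P.digits W)
  | W, i :: s => (P.digits W)[i]?.bind fun d => label P (P.child d W) s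

theorem digits_congr (h : W P.base = W' P.base) : P.digits W = P.digits W' := by
  simp only [digits, h]

theorem label_congr (h_mono : Monotone P.modulus) {s : List ℕ}
    (h : Set.EqOn W W' (Set.Iic (P.lookahead^[s.length] P.base))) :
    P.label W s = P.label W' s := by
  induction s generalizing W W' with
  | nil => simp only [label, digits_congr (h (Set.mem_Iic.2 le_rfl))]
  | cons i s ih =>
    rw [List.length_cons, Function.iterate_succ_apply'] at h
    have h_child : ∀ d, P.label (P.child d W) s = P.label (P.child d W') s := fun d =>
      ih fun n hn => child_congr (h.mono (Set.Iic_subset_Iic.2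
        (Nat.add_le_add_left (h_mono (Nat.add_le_add_right hn 2)) _)))
    simp only [label, h_child, digits_congr (h (Set.mem_Iic.2 (Nat.le_add_right _ _)))]

theorem isSome_label_append_iff {s : List ℕ} {i : ℕ} :
    (P.label W (s ++ [i])).isSome ↔ ∃ E, P.label W s = some E ∧ i < E.length := by
  induction s generalizing W with
  | nil =>
    have h := isSome_getElem? (P.digits W) i
    cases h_digit : (P.digits W)[i]? <;> simp_all [label]
  | cons j s ih => cases h : (P.digits W)[j]? <;> simp [label, h, ih]

theorem label_entries (h_le : ∀ n, n ≤ P.modulus n) (L : List (List I)) (s : List ℕ) :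
    P.label (entries L) s =
      (s.foldlM (fun L i => (P.digits (entries L))[i]?.map (P.childList L)) L).map fun L =>
        P.digits (entries L) := by
  induction s generalizing L with
  | nil => simp [label]
  | cons i s ih =>
    cases h : (P.digits (entries L))[i]? <;> simp [label, h, ← ih, entries_childList h_le]

end Labels

section Computable

variable {D I : Type*} [Primcodable D] [Primcodable I] {P : Splitter D I}

theorem IsComputable.thin (hP : P.IsComputable) :
    Computable fun t : (D × List (List I)) × ℕ => P.thin t.1.1 (entries t.1.2) t.2 := by
  have h_zero : Computable fun t : (D × List (List I)) × ℕ =>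
      (entries t.1.2 P.base).filter (P.select t.1.1) :=
    computable_list_filter (computable_entries.comp (Computable.snd.comp .fst) (.const _))
      (hP.select.comp (Computable.fst.comp (Computable.fst.comp .fst)) .snd)
  have h_near : Computable₂ fun (t : (((D × List (List I)) × ℕ) × ℕ × List I) × I) (i : I) =>
      P.near ((i, t.2), P.base + t.1.2.1) :=
    hP.near.comp (.pair (.pair .snd (Computable.snd.comp .fst))
      (Primrec.nat_add.to_comp.comp (.const _)
        (Computable.fst.comp (Computable.snd.comp (Computable.fst.comp .fst)))))
  have h_succ : Computable₂ fun (t : (D × List (List I)) × ℕ) (r : ℕ × List I) =>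
      (entries t.1.2 (P.base + (r.1 + 1))).filter fun i' =>
        r.2.any fun i => P.near ((i, i'), P.base + r.1) :=
    computable_list_filter
      (computable_entries.comp (Computable.snd.comp (Computable.fst.comp .fst))
        (Primrec.nat_add.to_comp.comp (.const _)
          (Computable.succ.comp (Computable.fst.comp .snd))))
      (computable_list_any (Computable.snd.comp (Computable.snd.comp .fst)) h_near)
  refine (Computable.nat_rec .snd h_zero h_succ).of_eq fun t => ?_
  induction t.2 with
  | zero => rfl
  | succ j ih => simp only [Splitter.thin, ← ih]

theorem IsComputable.childList (hP : P.IsComputable) : Computable₂ P.childList := by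
  have h_thin : Computable₂ fun (t : List (List I) × D) n =>
      P.thin t.2 (entries t.1) (P.modulus (n + 2)) :=
    hP.thin.comp (g := fun t : (List (List I) × D) × ℕ => ((t.1.2, t.1.1), P.modulus (t.2 + 2)))
      (.pair (.pair (Computable.snd.comp .fst) (Computable.fst.comp .fst))
      (hP.modulus.comp (Primrec.nat_add.to_comp.comp .snd (.const 2))))
  have h_pick : Computable₂ fun (t : (List (List I) × D) × ℕ) i => P.pick t.1.2 (t.2 + 2) i :=
    hP.pick.comp (g := fun t : ((List (List I) × D) × ℕ) × I => (t.1.1.2, t.1.2 + 2, t.2))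
      (.pair (Computable.snd.comp (Computable.fst.comp .fst))
      (.pair (Primrec.nat_add.to_comp.comp (Computable.snd.comp .fst) (.const 2)) .snd))
  have h_child : Computable₂ fun (t : List (List I) × D) n => P.child t.2 (entries t.1) n :=
    computable_list_map h_thin h_pick
  exact computable_list_map (f := fun t : List (List I) × D => List.range t.1.length)
    (g := fun t n => P.child t.2 (entries t.1) n)
    (Primrec.list_range.to_comp.comp (Computable.list_length.comp .fst)) h_child

variable [Fintype D]

theorem IsComputable.digits (hP : P.IsComputable) :
    Computable fun L : List (List I) => P.digits (entries L) :=
  computable_list_filter (p := fun (L : List (List I)) d => (entries L P.base).any (P.select d))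
    (.const _) (computable_list_any
      (f := fun t : List (List I) × D => entries t.1 P.base) (p := fun t i => P.select t.2 i)
      (computable_entries.comp .fst (.const _)) (hP.select.comp (Computable.snd.comp .fst) .snd))

theorem IsComputable.label (hP : P.IsComputable) (h_le : ∀ n, n ≤ P.modulus n) :
    Computable₂ fun (L : List (List I)) s => P.label (entries L) s := by
  have h_step : Computable fun t : (List (List I) × List ℕ) × List (List I) × ℕ =>
      (P.digits (entries t.2.1))[t.2.2]?.map (P.childList t.2.1) :=
    .option_map (Computable.list_getElem?.comp (hP.digits.comp (Computable.fst.comp .snd))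
      (Computable.snd.comp .snd))
      (hP.childList.comp (Computable.fst.comp (Computable.snd.comp .fst)) .snd)
  have h_descend : Computable fun t : List (List I) × List ℕ =>
      t.2.foldlM (fun L i => (P.digits (entries L))[i]?.map (P.childList L)) t.1 :=
    computable_list_foldlM .snd .fst h_step
  exact (Computable.option_map h_descend (hP.digits.comp .snd).to₂).of_eq fun t =>
    (label_entries h_le t.1 t.2).symm

end Computable

end Splitter

section Coinduction

namespace ExtendedIFS

variable {X D : Type*} [TopologicalSpace X] {S : ExtendedIFS X D}

theorem mem_treeRealisers_iff {T : DTree S.ar} {x : X} :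
    (T, x) ∈ S.treeRealisers ↔
      ∃ y, x = S.map T.root y ∧ ∀ κ, (T.subtree κ, y κ) ∈ S.treeRealisers := by
  conv_lhs => rw [treeRealisers, ← OrderHom.map_gfp]
  rfl

theorem subset_treeRealisers {R : Set (DTree S.ar × X)}
    (h : ∀ T x, (T, x) ∈ R → ∃ y, x = S.map T.root y ∧ ∀ κ, (T.subtree κ, y κ) ∈ R) :
    R ⊆ S.treeRealisers :=
  OrderHom.le_gfp _ fun p => h p.1 p.2

theorem mem_coindSet_of_mem_treeRealisers {T : DTree S.ar} {x : X}
    (h : (T, x) ∈ S.treeRealisers) : x ∈ S.coindSet := by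
  suffices h_le : Prod.snd '' S.treeRealisers ⊆ S.coindSet from h_le ⟨_, h, rfl⟩
  refine OrderHom.le_gfp _ ?_
  rintro _ ⟨⟨T, x⟩, h, rfl⟩
  obtain ⟨y, hx, hy⟩ := mem_treeRealisers_iff.1 h
  exact ⟨T.root, y, hx, fun κ => ⟨_, hy κ, rfl⟩⟩

theorem eq_hyperMap_get {e : HyperDigit D} {K : NonemptyCompacts X} {L : D → NonemptyCompacts X}
    (h : (K : Set X) = ⋃ d ∈ e.1, S.unary d '' L d) :
    K = S.hyperMap e fun κ => L (e.1.get κ) := by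
  refine NonemptyCompacts.ext (h.trans ?_)
  ext x
  simp [hyperMap, List.mem_iff_get]

end ExtendedIFS

end Coinduction

namespace Splitter

section Tree

variable {X D I : Type*} [Fintype D] {P : Splitter D I} {W : ℕ → List I}

/-- The tree with the labels `P.label W`. -/
def tree (P : Splitter D I) (W : ℕ → List I)
    (h : ∀ s, ∀ E ∈ P.label W s, E ≠ [] ∧ E.Nodup) :
    DTree fun e : HyperDigit D => e.1.length where
  label s := (P.label W s).pmap Subtype.mk (h s)
  root_mem := by simp [label]
  append_mem_iff s i := by
    simp only [Option.isSome_pmap, isSome_label_append_iff, Option.pmap_eq_some_iff]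
    constructor
    · rintro ⟨E, hE, hi⟩
      exact ⟨⟨E, h s E hE⟩, ⟨E, _, hE, rfl⟩, hi⟩
    · rintro ⟨_, ⟨E, _, hE, rfl⟩, hi⟩
      exact ⟨E, hE, hi⟩

theorem name_tree [Primcodable D] [DecidableEq D] (h : ∀ s, ∀ E ∈ P.label W s, E ≠ [] ∧ E.Nodup)
    (n : ℕ) :
    (P.tree W h).name n = Encodable.encode (P.label W (Denumerable.ofNat (List ℕ) n)) := by
  simp only [DTree.name, tree]
  generalize h _ = h'
  revert h'
  cases P.label W (Denumerable.ofNat (List ℕ) n) <;> intro _ <;> rfl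

variable [MetricSpace X] [CompactSpace X] {u : I → X} {K : NonemptyCompacts X}

theorem IsCorrect.ne_nil_and_nodup_of_mem_label {f : D → X → X} (hP : P.IsCorrect f u)
    (hW : ConvergesTo u W K) (s : List ℕ) : ∀ E ∈ P.label W s, E ≠ [] ∧ E.Nodup := by
  induction s generalizing W K with
  | nil =>
    rintro _ ⟨⟩
    exact ⟨hP.digits_ne_nil hW, P.nodup_digits W⟩
  | cons i s ih =>
    intro E hE
    obtain ⟨d, hd, hE⟩ := Option.bind_eq_some_iff.1 hE
    obtain ⟨L, hL, -⟩ := hP.exists_split hW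
    exact ih (hL d (List.mem_of_getElem? hd)) E hE

theorem IsCorrect.mem_treeRealisers {S : ExtendedIFS X D} (hP : P.IsCorrect S.unary u)
    (hW : ConvergesTo u W K) {T : DTree S.hyper.ar}
    (hT : ∀ s, (T.label s).map Subtype.val = P.label W s) : (T, K) ∈ S.hyper.treeRealisers := by
  refine ExtendedIFS.subset_treeRealisers (R := {p | ∃ W, ConvergesTo u W p.2 ∧
    ∀ s, (p.1.label s).map Subtype.val = P.label W s}) ?_ ⟨W, hW, hT⟩
  rintro T K ⟨W, hW, hT⟩
  obtain ⟨L, hL, hK⟩ := hP.exists_split hW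
  have h_root : T.root.1 = P.digits W := by
    have h := hT []
    rw [← Option.some_get T.root_mem] at h
    exact Option.some_injective _ h
  rw [← h_root] at hK hL
  refine ⟨_, ExtendedIFS.eq_hyperMap_get hK, fun κ =>
    ⟨P.child (T.root.1.get κ) W, hL _ (List.get_mem _ κ), fun s => (hT (κ :: s)).trans ?_⟩⟩
  rw [label, ← h_root, List.getElem?_eq_getElem κ.2]
  rfl

end Tree

theorem IsCorrect.computablyTranslates {X D I : Type*} [MetricSpace X] [CompactSpace X]
    [Primcodable D] [DecidableEq D] [Primcodable I] {P : Splitter D I} {S : ExtendedIFS X D}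
    {u : I → X} (hP : P.IsCorrect S.unary u) (hP_comp : P.IsComputable) :
    ComputablyTranslates (IsCauchyName (basicSubset u)) S.hyper.IsTreeName := by
  have := S.finite_digits
  cases nonempty_fintype D
  have h_operator : Computable₂ fun (l : List ℕ) n =>
      Encodable.encode (P.label (entries (l.map decodeCons)) (Denumerable.ofNat (List ℕ) n)) :=
    Computable.encode.comp ((hP_comp.label hP.le_modulus).comp
      (computable_list_map .fst (computable_decodeCons.comp .snd))
      ((Computable.ofNat _).comp .snd))
  have h_length : Computable fun n =>
      P.lookahead^[(Denumerable.ofNat (List ℕ) n).length] P.base + 1 :=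
    Computable.succ.comp (computable_nat_iterate (h := fun _ => P.lookahead)
      (Computable.list_length.comp (.ofNat _)) (.const _)
      (Primrec.nat_add.to_comp.comp (.const _)
        (hP_comp.modulus.comp (Primrec.nat_add.to_comp.comp .snd (.const 2)))))
  refine computablyTranslates_of_modulus h_operator h_length fun p K hp => ?_
  have h_labels := hP.ne_nil_and_nodup_of_mem_label hp.convergesTo
  have h_tree : (P.tree _ h_labels, K) ∈ S.hyper.treeRealisers :=
    hP.mem_treeRealisers hp.convergesTo fun s => by simp [tree, Option.map_pmap]
  refine ⟨_, ⟨_, rfl, h_tree⟩, fun n k hk => ?_⟩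
  refine (congrArg _ (label_congr hP.modulus_mono fun j hj => ?_)).trans (name_tree h_labels n).symm
  have hjk : j < k := (Nat.lt_succ_of_le hj).trans_le hk
  simp [entries, hjk]

end Splitter

section Words

theorem pair_le_pair {a a' b b' : ℕ} (ha : a ≤ a') (hb : b ≤ b') :
    Nat.pair a b ≤ Nat.pair a' b' :=
  (StrictMono.monotone (fun _ _ => Nat.pair_lt_pair_left b) ha).trans
    (StrictMono.monotone (fun _ _ => Nat.pair_lt_pair_right a') hb)

theorem encode_le_encode {s t : List ℕ}
    (h : ∀ i a : ℕ, s[i]? = some a → ∃ b, t[i]? = some b ∧ a ≤ b) :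
    Encodable.encode s ≤ Encodable.encode t := by
  induction s generalizing t with
  | nil => simp
  | cons a s ih =>
    obtain _ | ⟨b, t⟩ := t
    · simpa using h 0 a
    · have hab : a ≤ b := by simpa using h 0 a
      have hst := ih fun i a ha => by simpa using h (i + 1) a (by simpa using ha)
      simp only [Encodable.encode_list_cons, Encodable.encode_nat]
      exact Nat.succ_le_succ (pair_le_pair hab hst)

/-- A finite list of words of length `k` in which all such words with letters at most `m` occur. -/
def words (m k : ℕ) : List (List ℕ) :=
  ((List.range (Encodable.encode (List.replicate k m) + 1)).map (Denumerable.ofNat (List ℕ))).filter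
    fun w => w.length = k

variable {m k : ℕ} {w : List ℕ}

theorem length_of_mem_words (h : w ∈ words m k) : w.length = k := by
  simpa using (List.mem_filter.1 h).2

theorem mem_words (h_length : w.length = k) (h_le : ∀ i ∈ w, i ≤ m) : w ∈ words m k := by
  refine List.mem_filter.2 ⟨List.mem_map.2 ⟨Encodable.encode w, ?_, by simp⟩, by simpa⟩
  refine List.mem_range.2 (Nat.lt_succ_of_le (encode_le_encode fun i a ha => ⟨m, ?_, ?_⟩))
  · simpa [List.getElem?_replicate, ← h_length] using (List.getElem?_eq_some_iff.1 ha).1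
  · exact h_le a (List.mem_of_getElem? ha)

theorem encode_take_le (w : List ℕ) (j : ℕ) :
    Encodable.encode (w.take j) ≤ Encodable.encode w :=
  encode_le_encode fun i a ha => by
    obtain ⟨hi, rfl⟩ := List.getElem?_eq_some_iff.1 ha
    have hiw : i < w.length := (List.length_take_le' j w).trans_lt' hi
    exact ⟨_, List.getElem?_eq_getElem hiw, (List.getElem_take).le⟩

theorem encode_take_le_of_mem_words (h : w ∈ words m k) (j : ℕ) :
    Encodable.encode (w.take j) ≤ Encodable.encode (List.replicate k m) := by
  obtain ⟨n, hn, rfl⟩ := List.mem_map.1 (List.mem_filter.1 h).1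
  refine (encode_take_le _ j).trans ?_
  simpa [Nat.lt_succ_iff] using hn

theorem computable_encode_replicate (m : ℕ) :
    Computable fun k => Encodable.encode (List.replicate k m) :=
  Computable.encode.comp ((computable_nat_iterate (h := fun _ l => m :: l) .id (.const [])
    (Computable.list_cons.comp (.const m) .snd)).of_eq fun k => by
      dsimp only [id]
      induction k with
      | zero => rfl
      | succ k ih => rw [Function.iterate_succ_apply', ih, List.replicate_succ])

theorem computable_words (m : ℕ) : Computable (words m) := by
  refine computable_list_filter (p := fun k w => decide (List.length w = k)) ?_ ?_
  · exact computable_list_map (f := fun k =>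
      List.range (Encodable.encode (List.replicate k m) + 1))
      (Primrec.list_range.to_comp.comp (Computable.succ.comp (computable_encode_replicate m)))
      ((Computable.ofNat _).comp .snd)
  · exact Primrec.eq.decide.to_comp.comp (Computable.list_length.comp .snd) .fst

end Words

section Leaves

variable {D I : Type*} {g : D → I → I} {a : I} {lab lab' : List ℕ → List D}

/-- The index of a basic element that approximates the piece at the node `w` of the tree with the
labels `lab`, where `g d` approximates the digit `d` and `a` is an arbitrary index. -/
def leafApprox (g : D → I → I) (a : I) : (List ℕ → List D) → List ℕ → Option I
  | _, [] => some a
  | lab, i :: w =>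
    (lab [])[i]?.bind fun d => (leafApprox g a (fun s => lab (i :: s)) w).map (g d)

theorem leafApprox_congr {w : List ℕ} (h : ∀ j, lab (w.take j) = lab' (w.take j)) :
    leafApprox g a lab w = leafApprox g a lab' w := by
  induction w generalizing lab lab' with
  | nil => rfl
  | cons i w ih =>
    have h_root : lab [] = lab' [] := h 0
    have h_tail := ih (lab := fun s => lab (i :: s)) (lab' := fun s => lab' (i :: s))
      fun j => h (j + 1)
    rw [leafApprox, leafApprox, h_root, h_tail]

theorem leafApprox_eq_foldr (lab : List ℕ → List D) (w : List ℕ) :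
    leafApprox g a lab w = (List.range w.length).foldr (fun j o =>
      (w[j]?.bind fun i => (lab (w.take j))[i]?).bind fun d => o.map (g d)) (some a) := by
  induction w generalizing lab with
  | nil => rfl
  | cons i w ih => simp [leafApprox, ih, List.range_succ_eq_map, List.foldr_map]

/-- The indices `leafApprox g a lab w` for the nodes `w` of depth `k` that occur among the words
with letters at most `m`. -/
def leaves (m k : ℕ) (g : D → I → I) (a : I) (lab : List ℕ → List D) : List I :=
  (words m k).filterMap (leafApprox g a lab)

theorem leaves_congr {m k : ℕ} (h : ∀ s : List ℕ,
    Encodable.encode s ≤ Encodable.encode (List.replicate k m) → lab s = lab' s) :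
    leaves m k g a lab = leaves m k g a lab' :=
  List.filterMap_congr fun _ hw => leafApprox_congr fun j => h _ (encode_take_le_of_mem_words hw j)

end Leaves

section LeavesComputable

variable {α D I : Type*} [Primcodable α] [Primcodable D] [Primcodable I]

theorem computable_leafApprox {g : α × D × I → I} {lab : α → List ℕ → List D} {w : α → List ℕ}
    (hg : Computable g) (hlab : Computable₂ lab) (hw : Computable w) (a : I) :
    Computable fun t => leafApprox (fun d i => g (t, d, i)) a (lab t) (w t) := by
  have h_label : Computable fun t : α × ℕ => lab t.1 ((w t.1).take t.2) :=
    hlab.comp .fst (Primrec.list_take.to_comp.comp .snd (hw.comp .fst))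
  have h_digit : Computable fun t : α × ℕ =>
      (w t.1)[t.2]?.bind fun i => (lab t.1 ((w t.1).take t.2))[i]? :=
    Computable.option_bind (Computable.list_getElem?.comp (hw.comp .fst) .snd)
      (Computable.list_getElem?.comp (h_label.comp .fst) .snd)
  have h_step {e : α × ℕ → Option D} (he : Computable e) :
      Computable fun t : α × ℕ × Option I =>
        (e (t.1, t.2.1)).bind fun d => t.2.2.map fun i => g (t.1, d, i) :=
    Computable.option_bind (he.comp (.pair .fst (Computable.fst.comp .snd)))
      (Computable.option_map (Computable.snd.comp (Computable.snd.comp .fst))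
        (hg.comp (.pair (Computable.fst.comp (Computable.fst.comp .fst))
          (.pair (Computable.snd.comp .fst) .snd))))
  have h_range : Computable fun t => List.range (w t).length :=
    Primrec.list_range.to_comp.comp (Computable.list_length.comp hw)
  exact (computable_list_foldr h_range (.const (some a)) (h_step h_digit)).of_eq
    fun t => (leafApprox_eq_foldr (lab t) (w t)).symm

theorem computable_leaves {g : α × D × I → I} {lab : α → List ℕ → List D} {k : α → ℕ}
    (hg : Computable g) (hlab : Computable₂ lab) (hk : Computable k) (m : ℕ) (a : I) :
    Computable fun t => leaves m (k t) (fun d i => g (t, d, i)) a (lab t) :=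
  computable_list_filterMap ((computable_words m).comp hk)
    (computable_leafApprox (g := fun t : (α × List ℕ) × D × I => g (t.1.1, t.2))
      (lab := fun t => lab t.1)
      (hg.comp (.pair (Computable.fst.comp .fst) .snd))
      (hlab.comp (Computable.fst.comp .fst) .snd) .snd a)

end LeavesComputable

section TreeNames

variable {D : Type*} {ar : HyperDigit D → ℕ}

/-- The digits in the label of the node `s`, and none if `s` is not a node of the tree. -/
def DTree.labelList (T : DTree ar) (s : List ℕ) : List D :=
  ((T.label s).map Subtype.val).getD []

theorem DTree.labelList_nil (T : DTree ar) : T.labelList [] = T.root.1 := by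
  rw [labelList, ← Option.some_get T.root_mem]
  rfl

variable [Primcodable D]

/-- The digits in the label of the node `s` according to the initial segment `l` of the name of a
tree; the empty list if `l` is too short. -/
def initialLabelList (l : List ℕ) (s : List ℕ) : List D :=
  decodeList (l[Encodable.encode s]?.getD 0).pred

theorem computable_initialLabelList :
    Computable₂ (initialLabelList : List ℕ → List ℕ → List D) :=
  computable_decodeList.comp (Computable.pred.comp (Computable.option_getD
    (Computable.list_getElem?.comp .fst (Computable.encode.comp .snd)) (.const 0)))

theorem initialLabelList_name [DecidableEq D] (T : DTree ar) {k : ℕ} {s : List ℕ}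
    (h : Encodable.encode s < k) :
    initialLabelList ((List.range k).map T.name) s = T.labelList s := by
  have h_name : T.name (Encodable.encode s) = Encodable.encode (T.label s) := by simp [DTree.name]
  simp only [initialLabelList, DTree.labelList, List.getElem?_map, List.getElem?_range h,
    Option.map_some, Option.getD_some, h_name]
  cases T.label s with
  | none => exact decodeList_encode []
  | some e => exact decodeList_encode e.1

theorem computable_leaves_initialLabelList {I : Type*} [Primcodable I] {g : D × I × ℕ → I}
    {k p : ℕ → ℕ} (hg : Computable g) (hk : Computable k) (hp : Computable p) (m : ℕ) (a : I) :
    Computable₂ fun (l : List ℕ) n =>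
      leaves m (k n) (fun d i => g (d, i, p n)) a (initialLabelList l) := by
  have h_step : Computable fun t : (List ℕ × ℕ) × D × I => g (t.2.1, t.2.2, p t.1.2) :=
    hg.comp (.pair (Computable.fst.comp .snd) (.pair (Computable.snd.comp .snd)
      (hp.comp (Computable.snd.comp .fst))))
  exact computable_leaves h_step (lab := fun t : List ℕ × ℕ => initialLabelList t.1)
    (computable_initialLabelList.comp (Computable.fst.comp .fst) .snd) (hk.comp .snd) m a

end TreeNames

section LeafNets

variable {X D I : Type*} [MetricSpace X] {S : ExtendedIFS X D} {u : I → X} {q : NNReal} {δ Δ : ℝ}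

theorem ExtendedIFS.mem_hyperMap {e : HyperDigit D} {K : Fin e.1.length → NonemptyCompacts X}
    {x : X} : x ∈ S.hyperMap e K ↔ ∃ κ, ∃ y ∈ K κ, S.unary (e.1.get κ) y = x :=
  Set.mem_iUnion

theorem dist_le_of_lipschitzWith {f : X → X} {x y z : X} {k : ℕ} (hq : q ≤ 1) (hδ : 0 ≤ δ)
    (hf : LipschitzWith q f) (hz : dist (f y) z ≤ δ) (hxy : dist x y ≤ q ^ k * Δ + k * δ) :
    dist (f x) z ≤ q ^ (k + 1) * Δ + (k + 1 : ℕ) * δ :=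
  calc dist (f x) z ≤ q * dist x y + δ :=
        (dist_triangle _ _ _).trans (add_le_add (hf.dist_le_mul x y) hz)
    _ ≤ q * (q ^ k * Δ) + 1 * (k * δ) + δ := by
        have hq : (q : ℝ) ≤ 1 := hq
        gcongr
        refine (mul_le_mul_of_nonneg_left hxy q.coe_nonneg).trans ?_
        rw [mul_add]
        gcongr
    _ = q ^ (k + 1) * Δ + (k + 1 : ℕ) * δ := by push_cast; ring

variable {g : D → I → I} {a : I} {T : DTree S.hyper.ar} {K : NonemptyCompacts X}

theorem exists_leafApprox_of_mem [Fintype D] (hq : q ≤ 1) (hS : ∀ d, LipschitzWith q (S.unary d))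
    (hδ : 0 ≤ δ) (hg : ∀ d i, dist (S.unary d (u i)) (u (g d i)) ≤ δ) (ha : ∀ x, dist x (u a) ≤ Δ)
    (hT : (T, K) ∈ S.hyper.treeRealisers) (k : ℕ) {x : X} (hx : x ∈ K) :
    ∃ w ∈ words (Fintype.card D) k, ∃ i ∈ leafApprox g a T.labelList w,
      dist x (u i) ≤ q ^ k * Δ + k * δ := by
  suffices h : ∃ w : List ℕ, w.length = k ∧ (∀ i ∈ w, i ≤ Fintype.card D) ∧
      ∃ i ∈ leafApprox g a T.labelList w, dist x (u i) ≤ q ^ k * Δ + k * δ by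
    obtain ⟨w, h_length, h_le, h⟩ := h
    exact ⟨w, mem_words h_length h_le, h⟩
  induction k generalizing T K x with
  | zero => exact ⟨[], rfl, by simp, a, rfl, by simpa using ha x⟩
  | succ k ih =>
    obtain ⟨L, rfl, hL⟩ := ExtendedIFS.mem_treeRealisers_iff.1 hT
    obtain ⟨κ, y, hy, rfl⟩ := ExtendedIFS.mem_hyperMap.1 hx
    obtain ⟨w, h_length, h_le, i, hi, hyi⟩ := ih (hL κ) hy
    refine ⟨κ :: w, by simp [h_length], ?_, g (T.root.1.get κ) i, ?_,
      dist_le_of_lipschitzWith hq hδ (hS _) (hg _ i) hyi⟩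
    · exact List.forall_mem_cons.2 ⟨κ.2.le.trans T.root.2.2.length_le_card, h_le⟩
    · rw [leafApprox, DTree.labelList_nil, List.getElem?_eq_getElem κ.2]
      exact Option.mem_map_of_mem _ hi

theorem exists_mem_of_leafApprox (hq : q ≤ 1) (hS : ∀ d, LipschitzWith q (S.unary d))
    (hδ : 0 ≤ δ) (hg : ∀ d i, dist (S.unary d (u i)) (u (g d i)) ≤ δ) (ha : ∀ x, dist x (u a) ≤ Δ)
    (hT : (T, K) ∈ S.hyper.treeRealisers) {w : List ℕ} {i : I}
    (hi : i ∈ leafApprox g a T.labelList w) :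
    ∃ x ∈ K, dist x (u i) ≤ q ^ w.length * Δ + w.length * δ := by
  induction w generalizing T K i with
  | nil =>
    obtain rfl : a = i := Option.some_injective _ hi
    exact K.nonempty.imp fun x hx => ⟨hx, by simpa using ha x⟩
  | cons κ w ih =>
    obtain ⟨L, rfl, hL⟩ := ExtendedIFS.mem_treeRealisers_iff.1 hT
    obtain ⟨d, hd, hi⟩ := Option.bind_eq_some_iff.1 hi
    obtain ⟨j, hj, rfl⟩ := Option.map_eq_some_iff.1 hi
    rw [DTree.labelList_nil] at hd
    obtain ⟨hκ, rfl⟩ := List.getElem?_eq_some_iff.1 hd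
    obtain ⟨y, hy, hyj⟩ := ih (hL ⟨κ, hκ⟩) hj
    exact ⟨_, ExtendedIFS.mem_hyperMap.2 ⟨⟨κ, hκ⟩, y, hy, rfl⟩,
      dist_le_of_lipschitzWith hq hδ (hS _) (hg _ j) hyj⟩

theorem isNet_leaves [Fintype D] (hq : q ≤ 1) (hS : ∀ d, LipschitzWith q (S.unary d))
    (hδ : 0 ≤ δ) (hg : ∀ d i, dist (S.unary d (u i)) (u (g d i)) ≤ δ) (ha : ∀ x, dist x (u a) ≤ Δ)
    (hT : (T, K) ∈ S.hyper.treeRealisers) (k : ℕ) :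
    IsNet u (leaves (Fintype.card D) k g a T.labelList) K
      (q ^ k * Δ + k * δ) where
  exists_index x hx := by
    obtain ⟨w, hw, i, hi, hxi⟩ := exists_leafApprox_of_mem hq hS hδ hg ha hT k hx
    exact ⟨i, List.mem_filterMap.2 ⟨w, hw, hi⟩, hxi⟩
  exists_point i hi := by
    obtain ⟨w, hw, hi⟩ := List.mem_filterMap.1 hi
    exact length_of_mem_words hw ▸ exists_mem_of_leafApprox hq hS hδ hg ha hT hi

end LeafNets

section TreeToCauchy

theorem exists_computable_depth {q : ℝ} (hq₀ : 0 ≤ q) (hq₁ : q < 1) (Δ : ℝ) :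
    ∃ k : ℕ → ℕ, Computable k ∧ ∀ n, q ^ k n * Δ ≤ 2⁻¹ ^ n := by
  obtain ⟨e, he⟩ := exists_pow_lt_of_lt_one (by norm_num : (0 : ℝ) < 2⁻¹) hq₁
  obtain ⟨b, hb⟩ := pow_unbounded_of_one_lt Δ (one_lt_two : (1 : ℝ) < 2)
  refine ⟨fun n => e * (n + b), Primrec.nat_mul.to_comp.comp (.const e)
    (Primrec.nat_add.to_comp.comp .id (.const b)), fun n => ?_⟩
  calc q ^ (e * (n + b)) * Δ ≤ q ^ (e * (n + b)) * 2 ^ b := by gcongr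
    _ = (q ^ e) ^ (n + b) * 2 ^ b := by rw [pow_mul]
    _ ≤ 2⁻¹ ^ (n + b) * 2 ^ b := by gcongr
    _ = 2⁻¹ ^ n := by rw [pow_add, mul_assoc, ← mul_pow]; simp

theorem pow_mul_add_mul_le {q Δ : ℝ} {k n : ℕ} (h : q ^ k * Δ ≤ 2⁻¹ ^ (n + 2)) :
    q ^ k * Δ + k * 2⁻¹ ^ (n + 2 + k) ≤ 2⁻¹ ^ (n + 1) := by
  have hk : (k : ℝ) * 2⁻¹ ^ k ≤ 1 := by
    rw [inv_pow, ← div_eq_mul_inv]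
    exact div_le_one_of_le₀ (by exact_mod_cast Nat.lt_two_pow_self.le) (by positivity)
  calc q ^ k * Δ + k * 2⁻¹ ^ (n + 2 + k)
      = q ^ k * Δ + 2⁻¹ ^ (n + 2) * (k * 2⁻¹ ^ k) := by ring
    _ ≤ 2⁻¹ ^ (n + 2) + 2⁻¹ ^ (n + 2) * 1 := by gcongr
    _ = 2⁻¹ ^ (n + 1) := by ring

namespace ExtendedIFS

variable {X D I : Type*} [MetricSpace X] [Primcodable D] [Primcodable I] {S : ExtendedIFS X D}
  {u : I → X}

theorem IsComputableDigitSpace.exists_computable_unary (hS : S.IsComputableDigitSpace u) :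
    ∃ g : D × I × ℕ → I, Computable g ∧
      ∀ d i p, dist (S.unary d (u i)) (u (g (d, i, p))) < 2⁻¹ ^ p := by
  have := S.finite_digits
  choose G hG hG_dist using fun d => (hS.digits d).2
  refine ⟨fun t => G t.1 (fun _ => t.2.1, t.2.2), computable₂_of_finite
    (f := fun d (t : I × ℕ) => G d (fun _ => t.1, t.2)) fun d => ?_,
    fun d i p => hG_dist d (fun _ => i) p⟩
  have h_const : Computable fun t : I × ℕ => fun _ : Fin (S.ar d) => t.1 :=
    (Primrec.fin_curry.2 (Primrec.fst.comp Primrec.fst).to₂).to_comp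
  exact (hG d).comp (h_const.pair .snd)

theorem IsComputableDigitSpace.computablyTranslates [DecidableEq D]
    (hS : S.IsComputableDigitSpace u) :
    ComputablyTranslates S.hyper.IsTreeName (IsCauchyName (basicSubset u)) := by
  have := S.finite_digits
  cases nonempty_fintype D
  have := hS.digitSpace.compact
  have := hS.digitSpace.nonempty
  obtain ⟨a⟩ := hS.metric.dense.nonempty
  obtain ⟨q, hq₁, hq⟩ := hS.digitSpace.exists_lipschitzWith
  obtain ⟨g, hg, hg_dist⟩ := hS.exists_computable_unary
  obtain ⟨k, hk, hk_le⟩ := exists_computable_depth q.coe_nonneg hq₁ (Metric.diam (Set.univ : Set X))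
  let depth (n : ℕ) : ℕ := k (n + 2)
  have h_depth : Computable depth := hk.comp (Primrec.nat_add.to_comp.comp .id (.const 2))
  have h_precision : Computable fun n => n + 2 + depth n :=
    Primrec.nat_add.to_comp.comp (Primrec.nat_add.to_comp.comp .id (.const 2)) h_depth
  have h_operator : Computable₂ fun (l : List ℕ) n => (Encodable.encode (leaves (Fintype.card D)
      (depth n) (fun d i => g (d, i, n + 2 + depth n)) a (initialLabelList l))).pred :=
    Computable.pred.comp (Computable.encode.comp
      (computable_leaves_initialLabelList hg h_depth h_precision (Fintype.card D) a))
  have h_modulus : Computable fun n =>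
      Encodable.encode (List.replicate (depth n) (Fintype.card D)) + 1 :=
    Computable.succ.comp ((computable_encode_replicate _).comp h_depth)
  refine computablyTranslates_of_modulus h_operator h_modulus ?_
  rintro _ K ⟨T, rfl, hT⟩
  refine ⟨_, isCauchyName_of_isNet (u := u) (V := fun n => leaves (Fintype.card D) (depth n)
    (fun d i => g (d, i, n + 2 + depth n)) a T.labelList) fun n => ?_, fun n j hj => ?_⟩
  · refine (isNet_leaves hq₁.le hq (by positivity) (fun d i => (hg_dist d i _).le)
      (fun x => ?_) hT (depth n)).mono (pow_mul_add_mul_le (hk_le (n + 2)))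
    exact Metric.dist_le_diam_of_mem isCompact_univ.isBounded trivial trivial
  · rw [leaves_congr fun s hs => initialLabelList_name T ((Nat.lt_succ_of_le hs).trans_le hj)]

end ExtendedIFS

end TreeToCauchy

theorem ExtendedIFS.cauchySet_subset_coindSet {X D I : Type*} [MetricSpace X] [Encodable D]
    [Encodable I] {S : ExtendedIFS X D} {u : I → X}
    (h : ComputablyTranslates (IsCauchyName u) S.IsTreeName) : cauchySet u ⊆ S.coindSet := by
  obtain ⟨φ, -, hφ⟩ := h
  intro x hx
  choose w hw using hx
  obtain ⟨_, -, T, -, hT⟩ := hφ _ x ⟨w, fun _ => rfl, hw⟩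
  exact mem_coindSet_of_mem_treeRealisers hT

end DigitSpace

end

theorem mainTheorem12_general {X D I : Type*} [MetricSpace X] [Primcodable D] [DecidableEq D]
    [Primcodable I] (S : DigitSpace.ExtendedIFS X D) (u : I → X)
    (hS : S.IsComputableDigitSpace u)
    (hcov : S.IsWellCovering)
    (hdec : S.IsDecidable u)
    (hchoice : S.HasApproximableChoice u)
    (hunary : ∀ d, S.ar d = 1) :
    DigitSpace.cauchySet (DigitSpace.basicSubset u) = S.hyper.coindSet ∧
    DigitSpace.ComputablyTranslates
      (DigitSpace.IsCauchyName (DigitSpace.basicSubset u)) S.hyper.IsTreeName ∧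
    DigitSpace.ComputablyTranslates
      S.hyper.IsTreeName (DigitSpace.IsCauchyName (DigitSpace.basicSubset u)) := by
  have := hS.digitSpace.compact
  have := hS.digitSpace.nonempty
  have := hS.metric.dense.nonempty
  obtain ⟨P, hP_comp, hP⟩ := hS.exists_splitter hcov hdec hchoice hunary
  have h_tree : DigitSpace.ComputablyTranslates
      (DigitSpace.IsCauchyName (DigitSpace.basicSubset u)) S.hyper.IsTreeName :=
    hP.computablyTranslates hP_comp
  refine ⟨Set.Subset.antisymm ?_ ?_, h_tree, hS.computablyTranslates⟩
  · exact DigitSpace.ExtendedIFS.cauchySet_subset_coindSet h_tree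
  · exact (DigitSpace.cauchySet_basicSubset hS.metric.dense).symm ▸ Set.subset_univ _

theorem mainTheorem12 {X : Type*} [MetricSpace X] {m : ℕ}
    (S : DigitSpace.ExtendedIFS X (Fin m)) (u : ℕ → X)
    (hS : S.IsComputableDigitSpace u)
    (hcov : S.IsWellCovering)
    (hdec : S.IsDecidable u)
    (hchoice : S.HasApproximableChoice u)
    (hunary : ∀ d, S.ar d = 1) :
    DigitSpace.cauchySet (DigitSpace.basicSubset u) = S.hyper.coindSet ∧
    DigitSpace.ComputablyTranslates
      (DigitSpace.IsCauchyName (DigitSpace.basicSubset u)) S.hyper.IsTreeName ∧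
    DigitSpace.ComputablyTranslates
      S.hyper.IsTreeName (DigitSpace.IsCauchyName (DigitSpace.basicSubset u)) :=
  mainTheorem12_general S u hS hcov hdec hchoice hunary
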